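/- Let $A\subset\mathbb R^{m_a}$ and $B\subset\mathbb R^{m_b}$ be compact, and let $f:\mathbb R^n\times A\times B\to\mathbb R^n$, $L:\mathbb R^n\times A\times B\to\mathbb R$, $g,c:\mathbb R^n\to\mathbb R$ (time-invariant data). Assume that $f$ and $L$ are Lipschitz continuous in $x$, uniformly in $(a,b)\in A\times B$, and continuous in $(a,b)$ for each $x$; that for every $x$ the sets $\{f(x,a,b): a\in A, b\in B\}$ and $\{L(x,a,b): a\in A, b\in B\}$ are (compact and) convex; that $g$ and $c$ are Lipschitz continuous; and that $L$ and $g$ are bounded below. For $0\le t\le T$ let $\mathcal A(t)$, $\mathcal B(t)$, $\mathcal M(t)$ be the sets of measurable, essentially bounded functions on $[t,T]$ with values in $A$, $B$ and $[0,1]$, respectively. A map between spaces of such signals is called non-anticipative if, for every $s\in[t,T]$, whenever two inputs agree a.e. on $[t,s]$, so do the two outputs. Let $\Delta(t)$, $\Gamma(t)$, $\mathrm N_A(t)$, $\tilde\Gamma(t)$ be the sets of non-anticipative maps $\mathcal A(t)\to\mathcal B(t)$, $\mathcal B(t)\to\mathcal A(t)$, $\mathcal A(t)\to\mathcal M(t)$,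 $\mathcal B(t)\times\mathcal M(t)\to\mathcal A(t)$, respectively. For $(t,x,z)\in[0,T]\times\mathbb R^n\times\mathbb R$, $\alpha\in\mathcal A(t)$, $\beta\in\mathcal B(t)$ put $$J_1(t,x,z,\alpha,\beta)=\max_{\tau\in[t,T]}\max\Big\{\max_{s\in[t,\tau]}c(\mathrm x(s)),\ \int_t^\tau L(\mathrm x(s),\alpha(s),\beta(s))\,ds+g(\mathrm x(\tau))-z\Big\},$$ where $\dot{\mathrm x}(s)=f(\mathrm x(s),\alpha(s),\beta(s))$ on $[t,T]$ and $\mathrm x(t)=x$, and $$V_1^+(t,x,z)=\sup_{\delta\in\Delta(t)}\inf_{\alpha\in\mathcal A(t)}J_1(t,x,z,\alpha,\delta[\alpha]),\qquad V_1^-(t,x,z)=\inf_{\gamma\in\Gamma(t)}\sup_{\beta\in\mathcal B(t)}J_1(t,x,z,\gamma[\beta],\beta).$$ For $\mu\in\mathcal M(t)$ put $$\tilde J(t,x,z,\alpha,\beta,\mu)=\max\Big\{\max_{s\in[t,T]}c(\mathrm x(s)),\ g(\mathrm x(T))-\mathrm z(T)\Big\},$$ where $(\dot{\mathrm x}(s),\dot{\mathrm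 z}(s))=\mu(s)\,\big(f(\mathrm x(s),\alpha(s),\beta(s)),\,-L(\mathrm x(s),\alpha(s),\beta(s))\big)$ on $[t,T]$ and $(\mathrm x(t),\mathrm z(t))=(x,z)$. Then, for all $(t,x,z)\in[0,T]\times\mathbb R^n\times\mathbb R$, $$V_1^+(t,x,z)=\sup_{\delta\in\Delta(t),\,\nu_A\in\mathrm N_A(t)}\ \inf_{\alpha\in\mathcal A(t)}\tilde J(t,x,z,\alpha,\delta[\alpha],\nu_A[\alpha]),$$ $$V_1^-(t,x,z)=\inf_{\tilde\gamma\in\tilde\Gamma(t)}\ \sup_{\beta\in\mathcal B(t),\,\mu\in\mathcal M(t)}\tilde J(t,x,z,\tilde\gamma[\beta,\mu],\beta,\mu).$$ -/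

import Mathlib

noncomputable section

namespace ZeroSumGame

open MeasureTheory Set

section Controls

variable {E F G : Type*} [NormedAddCommGroup E] [NormedAddCommGroup F] [NormedAddCommGroup G]

/-- The control signals on `[t, T]` with values in `U`: Lebesgue measurable functions with finite
`L^∞(t, T)` norm. Values outside `[t, T]` are immaterial. -/
def controlSignals (U : Set E) (t T : ℝ) : Set (ℝ → E) :=
  {u | (∀ s ∈ Icc t T, u s ∈ U) ∧ MemLp u ⊤ (volume.restrict (Icc t T))}

/-- Two signals agree almost everywhere on `[t, s]`. -/
def AgreeUpTo (t s : ℝ) (u v : ℝ → E) : Prop :=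
  ∀ᵐ r ∂(volume.restrict (Icc t s)), u r = v r

/-- The non-anticipative (Elliott–Kalton) strategies on `[t, T]` that answer a signal with values
in `U` by a signal with values in `V`. -/
def strategies (U : Set E) (V : Set F) (t T : ℝ) :
    Set (controlSignals U t T → controlSignals V t T) :=
  {σ | ∀ s ∈ Icc t T, ∀ u v : controlSignals U t T,
    AgreeUpTo t s (u : ℝ → E) v → AgreeUpTo t s (σ u : ℝ → F) (σ v)}

/-- The non-anticipative strategies on `[t, T]` that answer a pair of signals, with values in `U`
and `V` respectively, by a signal with values in `W`. -/
def strategies₂ (U : Set E) (V : Set F) (W : Set G) (t T : ℝ) :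
    Set (controlSignals U t T × controlSignals V t T → controlSignals W t T) :=
  {σ | ∀ s ∈ Icc t T, ∀ (u u' : controlSignals U t T) (v v' : controlSignals V t T),
    AgreeUpTo t s (u : ℝ → E) u' → AgreeUpTo t s (v : ℝ → F) v' →
      AgreeUpTo t s (σ (u, v) : ℝ → G) (σ (u', v'))}

/-- The freezing control signals on `[t, T]`: signals with values in `[0, 1]`. -/
abbrev freezingSignals (t T : ℝ) : Set (ℝ → ℝ) := controlSignals (Icc (0 : ℝ) 1) t T

end Controls

section Dynamics

variable {E : Type*} [NormedAddCommGroup E] [NormedSpace ℝ E]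

/-- `y` is a (Carathéodory) solution on `[t, T]` of `y' = Φ(s, y)`, `y(t) = y₀`. -/
def IsSolution (Φ : ℝ → E → E) (t T : ℝ) (y₀ : E) (y : ℝ → E) : Prop :=
  ContinuousOn y (Icc t T) ∧ IntervalIntegrable (fun s => Φ s (y s)) volume t T ∧
    ∀ s ∈ Icc t T, y s = y₀ + ∫ r in t..s, Φ r (y r)

/-- The solution on `[t, T]` of `y' = Φ(s, y)`, `y(t) = y₀` (for the right-hand sides used below
it exists and is unique on `[t, T]`). -/
def solution (Φ : ℝ → E → E) (t T : ℝ) (y₀ : E) : ℝ → E :=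
  Classical.epsilon (IsSolution Φ t T y₀)

end Dynamics

section Game

variable {n p q : ℕ}

/-- The cost `J₁` of the free-terminal-time game with data `f`, `L`, `g`, `c`. -/
def J₁ (f : ℝ → EuclideanSpace ℝ (Fin n) → EuclideanSpace ℝ (Fin p) →
      EuclideanSpace ℝ (Fin q) → EuclideanSpace ℝ (Fin n))
    (L : ℝ → EuclideanSpace ℝ (Fin n) → EuclideanSpace ℝ (Fin p) →
      EuclideanSpace ℝ (Fin q) → ℝ)
    (g c : ℝ → EuclideanSpace ℝ (Fin n) → ℝ) (T t : ℝ) (x : EuclideanSpace ℝ (Fin n)) (z : ℝ)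
    (α : ℝ → EuclideanSpace ℝ (Fin p)) (β : ℝ → EuclideanSpace ℝ (Fin q)) : EReal :=
  let X : ℝ → EuclideanSpace ℝ (Fin n) := solution (fun s y => f s y (α s) (β s)) t T x
  ⨆ τ ∈ Icc t T, max (⨆ s ∈ Icc t τ, ((c s (X s) : ℝ) : EReal))
    (((∫ s in t..τ, L s (X s) (α s) (β s)) + g τ (X τ) - z : ℝ) : EReal)

/-- The upper value `V₁⁺`: player B chooses a strategy, then player A a control signal. -/
def V₁upper (A : Set (EuclideanSpace ℝ (Fin p))) (B : Set (EuclideanSpace ℝ (Fin q)))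
    (f : ℝ → EuclideanSpace ℝ (Fin n) → EuclideanSpace ℝ (Fin p) →
      EuclideanSpace ℝ (Fin q) → EuclideanSpace ℝ (Fin n))
    (L : ℝ → EuclideanSpace ℝ (Fin n) → EuclideanSpace ℝ (Fin p) →
      EuclideanSpace ℝ (Fin q) → ℝ)
    (g c : ℝ → EuclideanSpace ℝ (Fin n) → ℝ) (T t : ℝ) (x : EuclideanSpace ℝ (Fin n))
    (z : ℝ) : EReal :=
  ⨆ δ ∈ strategies A B t T, ⨅ α : controlSignals A t T, J₁ f L g c T t x z α (δ α)

/-- The lower value `V₁⁻`: player A chooses a strategy, then player B a control signal. -/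
def V₁lower (A : Set (EuclideanSpace ℝ (Fin p))) (B : Set (EuclideanSpace ℝ (Fin q)))
    (f : ℝ → EuclideanSpace ℝ (Fin n) → EuclideanSpace ℝ (Fin p) →
      EuclideanSpace ℝ (Fin q) → EuclideanSpace ℝ (Fin n))
    (L : ℝ → EuclideanSpace ℝ (Fin n) → EuclideanSpace ℝ (Fin p) →
      EuclideanSpace ℝ (Fin q) → ℝ)
    (g c : ℝ → EuclideanSpace ℝ (Fin n) → ℝ) (T t : ℝ) (x : EuclideanSpace ℝ (Fin n))
    (z : ℝ) : EReal :=
  ⨅ γ ∈ strategies B A t T, ⨆ β : controlSignals B t T, J₁ f L g c T t x z (γ β) β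

/-- The cost `J̃` of the fixed-terminal-time game with time-invariant data: the augmented state
`(x, z)` follows the dynamics `(f, -L)` multiplied by the freezing control `μ`. -/
def Jtilde (f : EuclideanSpace ℝ (Fin n) → EuclideanSpace ℝ (Fin p) →
      EuclideanSpace ℝ (Fin q) → EuclideanSpace ℝ (Fin n))
    (L : EuclideanSpace ℝ (Fin n) → EuclideanSpace ℝ (Fin p) → EuclideanSpace ℝ (Fin q) → ℝ)
    (g c : EuclideanSpace ℝ (Fin n) → ℝ) (T t : ℝ) (x : EuclideanSpace ℝ (Fin n)) (z : ℝ)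
    (α : ℝ → EuclideanSpace ℝ (Fin p)) (β : ℝ → EuclideanSpace ℝ (Fin q)) (μ : ℝ → ℝ) : EReal :=
  let Y : ℝ → EuclideanSpace ℝ (Fin n) × ℝ :=
    solution (fun s y => μ s • (f y.1 (α s) (β s), -L y.1 (α s) (β s))) t T (x, z)
  max (⨆ s ∈ Icc t T, ((c (Y s).1 : ℝ) : EReal)) ((g (Y T).1 - (Y T).2 : ℝ) : EReal)

/-- The standing assumptions on time-invariant data. -/
structure StandingAssumptions (A : Set (EuclideanSpace ℝ (Fin p)))
    (B : Set (EuclideanSpace ℝ (Fin q)))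
    (f : EuclideanSpace ℝ (Fin n) → EuclideanSpace ℝ (Fin p) →
      EuclideanSpace ℝ (Fin q) → EuclideanSpace ℝ (Fin n))
    (L : EuclideanSpace ℝ (Fin n) → EuclideanSpace ℝ (Fin p) → EuclideanSpace ℝ (Fin q) → ℝ)
    (g c : EuclideanSpace ℝ (Fin n) → ℝ) : Prop where
  compact_A : IsCompact A
  compact_B : IsCompact B
  lipschitz_f : ∃ K : NNReal, ∀ a ∈ A, ∀ b ∈ B, LipschitzWith K (fun x => f x a b)
  continuous_f : ∀ x, ContinuousOn
    (fun ab : EuclideanSpace ℝ (Fin p) × EuclideanSpace ℝ (Fin q) => f x ab.1 ab.2) (A ×ˢ B)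
  lipschitz_L : ∃ K : NNReal, ∀ a ∈ A, ∀ b ∈ B, LipschitzWith K (fun x => L x a b)
  continuous_L : ∀ x, ContinuousOn
    (fun ab : EuclideanSpace ℝ (Fin p) × EuclideanSpace ℝ (Fin q) => L x ab.1 ab.2) (A ×ˢ B)
  /-- The sets of velocities are convex (they are compact by continuity). -/
  convex_f : ∀ x, Convex ℝ {v | ∃ a ∈ A, ∃ b ∈ B, f x a b = v}
  /-- The sets of stage costs are convex (they are compact by continuity). -/
  convex_L : ∀ x, Convex ℝ {l | ∃ a ∈ A, ∃ b ∈ B, L x a b = l}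
  lipschitz_g : ∃ K : NNReal, LipschitzWith K g
  lipschitz_c : ∃ K : NNReal, LipschitzWith K c
  bddBelow_L : ∃ m : ℝ, ∀ x, ∀ a ∈ A, ∀ b ∈ B, m ≤ L x a b
  bddBelow_g : ∃ m : ℝ, ∀ x, m ≤ g x

end Game

end ZeroSumGame

end

/-! Over the augmented state `(x, z)` with velocity `(f, -L)` (`augmentedField`) the integral cost
becomes a state component, and both games compare functions `φ` (from `c`) and `ψ` (from `g` and
`z`) along a single trajectory. The claim is that the power to slow down the clock is worth as much
to player B as the choice of a stopping time.

Free cost ≤ frozen cost: freezing imitates stopping. For the upper value B keeps its strategy and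
freezes when the larger of `φ` and `ψ` first reaches the guaranteed value, a rule that uses only the
past (`iSup_freeCost_le`). For the lower value B runs unfrozen up to any `τ` and then freezes
(`iInf_freeCost_le`).

Frozen cost ≤ free cost + `ε`: extremal shift in the manner of Krasovskii and Subbotin. A frozen
motion `Y`, observed with step `h`, is coupled with an unfrozen motion `X` that has its own, slower
clock `σ`. Let `p = Y - X` and let `H` be the value of the static game with payoff `G p (F X a b)`.
In the frozen game A keeps the velocity of `Y` along `p` below `max H 0`, whatever B and the
freezing do; in the original game B keeps that of `X` above `H`, and if `H ≤ 0` then `X` waits. Up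
to the accuracy `η`, the first-order growth of `G p p` is then only what the Lipschitz constant
allows, so a discrete Gronwall argument keeps `Y` close to `X` (`extremalShift_le`), and the costs
follow (`exists_fixedCost_le`).

Of the two guided signals one is the answer of the strategy being built and the other belongs to a
simulated opponent. For the upper value A commits first in the static game and B's signal is the
answer (`exists_strategy_original`); for the lower value B commits first and A's signal is the
answer (`exists_strategy_frozen`). Non-anticipativity holds because each decision changes a signal
only from the current time of its own clock on (`run_agree_B`, `run_agree_A`). -/

noncomputable section

namespace ZeroSumGame

open MeasureTheory Set

/-! ### Carathéodory equations: uniqueness, a priori bound, existence. -/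

section CaratheodoryEquations

variable {V : Type*} [NormedAddCommGroup V]

/-- A Carathéodory right-hand side on `[t, T]`: `K`-Lipschitz in the state, measurable along
continuous curves and bounded by `M` at the state `y₀`. -/
structure IsCaratheodory (Φ : ℝ → V → V) (K M t T : ℝ) (y₀ : V) : Prop where
  lip : ∀ s ∈ Icc t T, ∀ y y', ‖Φ s y - Φ s y'‖ ≤ K * ‖y - y'‖
  meas : ∀ y : ℝ → V, ContinuousOn y (Icc t T) →
    AEStronglyMeasurable (fun s => Φ s (y s)) (volume.restrict (Icc t T))
  bound : ∀ s ∈ Icc t T, ‖Φ s y₀‖ ≤ M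
  nonneg : 0 ≤ K

variable {Φ : ℝ → V → V} {K M t T : ℝ} {y₀ : V}

theorem IsCaratheodory.mono (h : IsCaratheodory Φ K M t T y₀) {s : ℝ} (hs : s ∈ Icc t T) :
    IsCaratheodory Φ K M t s y₀ where
  lip r hr := h.lip r ⟨hr.1, hr.2.trans hs.2⟩
  meas y hy := by
    -- A curve continuous on `[t, s]` only is stopped at `s` to obtain one on `[t, T]`.
    have hy' : ContinuousOn (fun r => y (min r s)) (Icc t T) :=
      hy.comp (by fun_prop) fun r hr => ⟨le_min hr.1 hs.1, min_le_right _ _⟩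
    have := (h.meas _ hy').mono_measure
      (Measure.restrict_mono (Icc_subset_Icc_right hs.2) le_rfl)
    refine this.congr ?_
    filter_upwards [ae_restrict_mem measurableSet_Icc] with r hr
    rw [min_eq_left hr.2]
  bound r hr := h.bound r ⟨hr.1, hr.2.trans hs.2⟩
  nonneg := h.nonneg

theorem IsCaratheodory.integrableOn (h : IsCaratheodory Φ K M t T y₀) {y : ℝ → V}
    (hy : ContinuousOn y (Icc t T)) : IntegrableOn (fun s => Φ s (y s)) (Icc t T) := by
  obtain ⟨C, hC⟩ := isCompact_Icc.exists_bound_of_continuousOn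
    (hy.sub (continuousOn_const (c := y₀)))
  refine IntegrableOn.of_bound (by simp) (h.meas y hy) (M + K * C) ?_
  filter_upwards [ae_restrict_mem measurableSet_Icc] with r hr
  have h1 := h.lip r hr (y r) y₀
  have h2 := h.bound r hr
  have h3 := mul_le_mul_of_nonneg_left (hC r hr) h.nonneg
  have h4 := norm_sub_norm_le (Φ r (y r)) (Φ r y₀)
  rw [Pi.sub_apply] at h3
  linarith

theorem IsCaratheodory.intervalIntegrable (h : IsCaratheodory Φ K M t T y₀) {y : ℝ → V}
    (hy : ContinuousOn y (Icc t T)) {a b : ℝ} (ha : a ∈ Icc t T) (hb : b ∈ Icc t T) :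
    IntervalIntegrable (fun s => Φ s (y s)) volume a b := by
  refine IntegrableOn.intervalIntegrable ((h.integrableOn hy).mono_set ?_)
  exact uIcc_subset_Icc ha hb

variable [NormedSpace ℝ V]

theorem IsSolution.of_restrict {y : ℝ → V} (hy : IsSolution Φ t T y₀ y) {s : ℝ}
    (hs : s ∈ Icc t T) : IsSolution Φ t s y₀ y :=
  ⟨hy.1.mono (Icc_subset_Icc_right hs.2),
    hy.2.1.mono_set (by
      rw [uIcc_of_le hs.1, uIcc_of_le (hs.1.trans hs.2)]; exact Icc_subset_Icc_right hs.2),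
    fun r hr => hy.2.2 r ⟨hr.1, hr.2.trans hs.2⟩⟩

/-- A solution is still a solution after a modification of the right-hand side on a null set of
times. -/
theorem IsSolution.congr_field {Ψ : ℝ → V → V} {y : ℝ → V} (hy : IsSolution Φ t T y₀ y)
    (hΨ : ∀ᵐ r ∂(volume.restrict (Icc t T)), Φ r = Ψ r) (htT : t ≤ T) :
    IsSolution Ψ t T y₀ y := by
  have key : ∀ s ∈ Icc t T, ∀ᵐ r ∂(volume.restrict (uIoc t s)), Φ r (y r) = Ψ r (y r) := by
    intro s hs
    have : uIoc t s ⊆ Icc t T := by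
      rw [uIoc_of_le hs.1]
      exact fun r hr => ⟨hr.1.le, hr.2.trans hs.2⟩
    filter_upwards [ae_restrict_of_ae_restrict_of_subset this hΨ] with r hr
    rw [hr]
  refine ⟨hy.1, hy.2.1.congr_ae (key T ⟨htT, le_rfl⟩), fun s hs => ?_⟩
  rw [hy.2.2 s hs, intervalIntegral.integral_congr_ae_restrict (key s hs)]

theorem IsSolution.sub_eq_integral {y : ℝ → V} (hy : IsSolution Φ t T y₀ y) {a b : ℝ}
    (ha : a ∈ Icc t T) (hb : b ∈ Icc t T) : y b - y a = ∫ r in a..b, Φ r (y r) := by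
  have hsub : ∀ s ∈ Icc t T, IntervalIntegrable (fun s => Φ s (y s)) volume t s := fun s hs =>
    hy.2.1.mono_set (by
      rw [uIcc_of_le hs.1, uIcc_of_le (hs.1.trans hs.2)]; exact Icc_subset_Icc_right hs.2)
  rw [hy.2.2 a ha, hy.2.2 b hb,
    ← intervalIntegral.integral_interval_sub_left (hsub b hb) (hsub a ha)]
  abel

theorem integral_exp_mul_le {l : ℝ} (hl : 0 < l) (t s : ℝ) :
    ∫ r in t..s, Real.exp (l * (r - t)) ≤ Real.exp (l * (s - t)) / l := by
  have : ∀ r ∈ uIcc t s, HasDerivAt (fun r => Real.exp (l * (r - t)) / l)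
      (Real.exp (l * (r - t))) r := by
    intro r _
    have h1 : HasDerivAt (fun r => l * (r - t)) l r := by
      simpa using ((hasDerivAt_id r).sub_const t).const_mul l
    have := h1.exp.div_const l
    rwa [mul_div_assoc, div_self hl.ne', mul_one] at this
  rw [intervalIntegral.integral_eq_sub_of_hasDerivAt this
    (Continuous.intervalIntegrable (by fun_prop) _ _)]
  have : 0 < Real.exp (l * (t - t)) / l := by positivity
  linarith

/-- The Picard operator, conjugated with the weight `exp (l (s - t))`. -/
def weightedPicard (Φ : ℝ → V → V) (l t : ℝ) (y₀ : V) (u : ℝ → V) (s : ℝ) : V :=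
  Real.exp (-(l * (s - t))) • (y₀ + ∫ r in t..s, Φ r (Real.exp (l * (r - t)) • u r))

theorem IsCaratheodory.weightedPicard_continuousOn (h : IsCaratheodory Φ K M t T y₀) {l : ℝ}
    {u : ℝ → V} (hu : ContinuousOn u (Icc t T)) :
    ContinuousOn (weightedPicard Φ l t y₀ u) (Icc t T) := by
  have h1 : ContinuousOn (fun r => Real.exp (l * (r - t)) • u r) (Icc t T) :=
    ContinuousOn.smul (by fun_prop) hu
  refine ContinuousOn.smul (by fun_prop) (continuousOn_const.add ?_)
  rcases le_or_gt t T with htT | htT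
  · have := intervalIntegral.continuousOn_primitive_interval (a := t) (b := T) (μ := volume)
      (f := fun r => Φ r (Real.exp (l * (r - t)) • u r))
      (by rw [uIcc_of_le htT]; exact h.integrableOn h1)
    rwa [uIcc_of_le htT] at this
  · simp [Icc_eq_empty htT.not_ge]

/-- The weight `exp (l (r - t))` integrates to at most `exp (l (s - t)) / l`, so the Lipschitz
factor is `K / l`, which is below `1 / 2` for `l = 2 K + 1` whatever the length of the interval.
Uniqueness, the a priori bound and existence all rest on this contraction. -/
theorem IsCaratheodory.weightedPicard_dist_le (h : IsCaratheodory Φ K M t T y₀)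
    {u v : ℝ → V} (hu : ContinuousOn u (Icc t T)) (hv : ContinuousOn v (Icc t T)) {d : ℝ}
    (hd : ∀ s ∈ Icc t T, ‖u s - v s‖ ≤ d) {s : ℝ} (hs : s ∈ Icc t T) :
    ‖weightedPicard Φ (2 * K + 1) t y₀ u s - weightedPicard Φ (2 * K + 1) t y₀ v s‖ ≤ d / 2 := by
  have hK := h.nonneg
  set l := 2 * K + 1 with hl
  have hl0 : 0 < l := by positivity
  have hd0 : 0 ≤ d := (norm_nonneg _).trans (hd s hs)
  have hc : ∀ w : ℝ → V, ContinuousOn w (Icc t T) →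
      IntervalIntegrable (fun r => Φ r (Real.exp (l * (r - t)) • w r)) volume t s := fun w hw =>
    h.intervalIntegrable (ContinuousOn.smul (by fun_prop) hw) ⟨le_rfl, hs.1.trans hs.2⟩ hs
  have h1 : ‖∫ r in t..s, (Φ r (Real.exp (l * (r - t)) • u r) -
      Φ r (Real.exp (l * (r - t)) • v r))‖ ≤ ∫ r in t..s, K * d * Real.exp (l * (r - t)) := by
    refine intervalIntegral.norm_integral_le_of_norm_le hs.1 (Filter.Eventually.of_forall ?_)
      (Continuous.intervalIntegrable (by fun_prop) _ _)
    intro r hr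
    have hr' : r ∈ Icc t T := ⟨hr.1.le, hr.2.trans hs.2⟩
    refine (h.lip r hr' _ _).trans ?_
    rw [← smul_sub, norm_smul, Real.norm_eq_abs, Real.abs_exp]
    have := mul_le_mul_of_nonneg_left (hd r hr') (mul_nonneg hK (Real.exp_pos (l * (r - t))).le)
    linarith
  rw [intervalIntegral.integral_const_mul] at h1
  have h2 := mul_le_mul_of_nonneg_left (integral_exp_mul_le hl0 t s) (mul_nonneg hK hd0)
  have h3 : weightedPicard Φ l t y₀ u s - weightedPicard Φ l t y₀ v s =
      Real.exp (-(l * (s - t))) • ∫ r in t..s, (Φ r (Real.exp (l * (r - t)) • u r) -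
      Φ r (Real.exp (l * (r - t)) • v r)) := by
    rw [intervalIntegral.integral_sub (hc u hu) (hc v hv), weightedPicard, weightedPicard,
      ← smul_sub]
    congr 1
    abel
  rw [h3, norm_smul, Real.norm_eq_abs, Real.abs_exp]
  calc _ ≤ Real.exp (-(l * (s - t))) * (K * d * (Real.exp (l * (s - t)) / l)) :=
        mul_le_mul_of_nonneg_left (h1.trans h2) (Real.exp_pos _).le
    _ = K * d / l := by
        rw [Real.exp_neg]; field_simp
    _ ≤ d / 2 := by
        rw [div_le_div_iff₀ hl0 two_pos, hl]; nlinarith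

theorem IsSolution.weightedPicard_eq {y : ℝ → V} (hy : IsSolution Φ t T y₀ y) (l : ℝ) {s : ℝ}
    (hs : s ∈ Icc t T) :
    weightedPicard Φ l t y₀ (fun r => Real.exp (-(l * (r - t))) • y r) s =
      Real.exp (-(l * (s - t))) • y s := by
  simp only [weightedPicard, smul_smul, ← Real.exp_add, add_neg_cancel, Real.exp_zero, one_smul]
  rw [← hy.2.2 s hs]

theorem continuousOn_exp_weight {y : ℝ → V} (hy : ContinuousOn y (Icc t T)) (l : ℝ) :
    ContinuousOn (fun r => Real.exp (-(l * (r - t))) • y r) (Icc t T) :=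
  ContinuousOn.smul (by fun_prop) hy

/-- At a maximizer of the weighted distance the contraction bounds this maximum by half of itself.
-/
theorem IsCaratheodory.eqOn (h : IsCaratheodory Φ K M t T y₀) {y y' : ℝ → V}
    (hy : IsSolution Φ t T y₀ y) (hy' : IsSolution Φ t T y₀ y') : EqOn y y' (Icc t T) := by
  rcases le_or_gt t T with htT | htT
  swap
  · simp [Icc_eq_empty htT.not_ge]
  set l := 2 * K + 1 with hl
  obtain ⟨s₀, hs₀, hmax⟩ := isCompact_Icc.exists_isMaxOn (nonempty_Icc.2 htT)
    ((continuousOn_exp_weight hy.1 l).sub (continuousOn_exp_weight hy'.1 l)).norm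
  have h1 := h.weightedPicard_dist_le (continuousOn_exp_weight hy.1 l) (continuousOn_exp_weight hy'.1 l)
    (fun s hs => hmax hs) hs₀
  rw [← hl, hy.weightedPicard_eq l hs₀, hy'.weightedPicard_eq l hs₀] at h1
  simp only [Pi.sub_apply] at h1
  intro s hs
  have h2 := hmax hs
  simp only [mem_ofPred_eq, Pi.sub_apply] at h2
  have h3 : ‖Real.exp (-(l * (s - t))) • y s - Real.exp (-(l * (s - t))) • y' s‖ ≤ 0 := by
    linarith [norm_nonneg (Real.exp (-(l * (s₀ - t))) • y s₀ - Real.exp (-(l * (s₀ - t))) • y' s₀)]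
  rw [← smul_sub] at h3
  simpa [(Real.exp_pos _).ne', sub_eq_zero] using h3

/-- The fixed point of a `1 / 2`-contraction is within twice the displacement of any other point.
That point is the weighted constant curve `y₀`, displaced by at most `M (T - t)`. -/
theorem IsCaratheodory.norm_sub_le (h : IsCaratheodory Φ K M t T y₀) {y : ℝ → V}
    (hy : IsSolution Φ t T y₀ y) {s : ℝ} (hs : s ∈ Icc t T) :
    ‖y s - y₀‖ ≤ Real.exp ((2 * K + 1) * (T - t)) * (2 * (M * (T - t))) := by
  have hK := h.nonneg
  set l := 2 * K + 1 with hl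
  have htT := hs.1.trans hs.2
  obtain ⟨s₀, hs₀, hmax⟩ := isCompact_Icc.exists_isMaxOn (nonempty_Icc.2 htT)
    ((continuousOn_exp_weight hy.1 l).sub (continuousOn_exp_weight (y := fun _ => y₀)
      continuousOn_const l)).norm
  have h1 := h.weightedPicard_dist_le (continuousOn_exp_weight hy.1 l)
    (continuousOn_exp_weight (y := fun _ => y₀) continuousOn_const l)
    (fun s hs => hmax hs) hs₀
  rw [← hl, hy.weightedPicard_eq l hs₀] at h1
  simp only [Pi.sub_apply] at h1
  have h2 : ‖weightedPicard Φ l t y₀ (fun r => Real.exp (-(l * (r - t))) • y₀) s₀ -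
      Real.exp (-(l * (s₀ - t))) • y₀‖ ≤ M * (T - t) := by
    simp only [weightedPicard, smul_smul, ← Real.exp_add, add_neg_cancel, Real.exp_zero, one_smul]
    rw [← smul_sub, norm_smul, Real.norm_eq_abs, Real.abs_exp, add_sub_cancel_left]
    have h3 : ‖∫ r in t..s₀, Φ r y₀‖ ≤ M * |s₀ - t| := by
      refine intervalIntegral.norm_integral_le_of_norm_le_const fun r hr => ?_
      rw [uIoc_of_le hs₀.1] at hr
      exact h.bound r ⟨hr.1.le, hr.2.trans hs₀.2⟩
    rw [abs_of_nonneg (sub_nonneg.2 hs₀.1)] at h3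
    have hM : 0 ≤ M := (norm_nonneg _).trans (h.bound _ hs)
    have h4 : Real.exp (-(l * (s₀ - t))) ≤ 1 := by
      rw [Real.exp_le_one_iff]
      have := mul_nonneg (by positivity : 0 ≤ l) (sub_nonneg.2 hs₀.1)
      linarith
    calc _ ≤ 1 * ‖∫ r in t..s₀, Φ r y₀‖ := by gcongr
      _ ≤ M * (s₀ - t) := by rwa [one_mul]
      _ ≤ _ := by gcongr; exact hs₀.2
  have h5 := norm_sub_le_norm_sub_add_norm_sub (Real.exp (-(l * (s₀ - t))) • y s₀)
    (weightedPicard Φ l t y₀ (fun r => Real.exp (-(l * (r - t))) • y₀) s₀)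
    (Real.exp (-(l * (s₀ - t))) • y₀)
  have h6 := hmax hs
  simp only [mem_ofPred_eq, Pi.sub_apply] at h6
  rw [← smul_sub, norm_smul, Real.norm_eq_abs, Real.abs_exp] at h6
  have h7 : Real.exp (-(l * (s - t))) * ‖y s - y₀‖ ≤ 2 * (M * (T - t)) := by linarith
  have h8 : ‖y s - y₀‖ = Real.exp (l * (s - t)) * (Real.exp (-(l * (s - t))) * ‖y s - y₀‖) := by
    rw [← mul_assoc, ← Real.exp_add, add_neg_cancel, Real.exp_zero, one_mul]
  rw [h8]
  have hp : 0 ≤ Real.exp (-(l * (s - t))) * ‖y s - y₀‖ := by positivity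
  refine mul_le_mul (Real.exp_le_exp.2 ?_) h7 hp (Real.exp_pos _).le
  gcongr
  exact hs.2

theorem IsCaratheodory.exists_isSolution [CompleteSpace V] (h : IsCaratheodory Φ K M t T y₀)
    (htT : t ≤ T) : ∃ y, IsSolution Φ t T y₀ y := by
  set l := 2 * K + 1 with hl
  have hcont : ∀ u : C(Icc t T, V), ContinuousOn (IccExtend htT u) (Icc t T) := fun u =>
    u.continuous.Icc_extend'.continuousOn
  let G : C(Icc t T, V) → C(Icc t T, V) := fun u =>
    ⟨fun s => weightedPicard Φ l t y₀ (IccExtend htT u) s,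
      continuousOn_iff_continuous_domRestrict.1 (h.weightedPicard_continuousOn (hcont u))⟩
  have hG : ContractingWith (1 / 2) G := by
    refine ⟨by norm_num, LipschitzWith.of_dist_le_mul fun u v => ?_⟩
    rw [ContinuousMap.dist_le (by positivity)]
    intro s
    rw [dist_eq_norm]
    refine (h.weightedPicard_dist_le (hcont u) (hcont v) (d := dist u v) ?_ s.2).trans
      (le_of_eq ?_)
    · intro r hr
      rw [IccExtend_of_mem _ _ hr, IccExtend_of_mem _ _ hr, ← dist_eq_norm]
      exact ContinuousMap.dist_apply_le_dist _
    · push_cast; ring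
  obtain ⟨u, hu, -⟩ := hG.exists_fixedPoint 0 (edist_ne_top _ _)
  have hfix : ∀ s ∈ Icc t T, IccExtend htT u s = weightedPicard Φ l t y₀ (IccExtend htT u) s := by
    intro s hs
    rw [IccExtend_of_mem _ _ hs]
    conv_lhs => rw [← hu.eq]
    rfl
  have hc : ContinuousOn (fun s => Real.exp (l * (s - t)) • IccExtend htT u s) (Icc t T) :=
    ContinuousOn.smul (by fun_prop) (hcont u)
  refine ⟨fun s => Real.exp (l * (s - t)) • IccExtend htT u s, hc,
    h.intervalIntegrable hc ⟨le_rfl, htT⟩ ⟨htT, le_rfl⟩, fun s hs => ?_⟩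
  beta_reduce
  rw [hfix s hs, weightedPicard, smul_smul, ← Real.exp_add, add_neg_cancel, Real.exp_zero, one_smul]

theorem IsCaratheodory.isSolution_solution [CompleteSpace V] (h : IsCaratheodory Φ K M t T y₀)
    (htT : t ≤ T) : IsSolution Φ t T y₀ (solution Φ t T y₀) :=
  Classical.epsilon_spec (h.exists_isSolution htT)

end CaratheodoryEquations

/-! ### Signals: agreement up to a time, splicing, feedback responses. -/

section Agreement

variable {E : Type*} {t : ℝ}

theorem AgreeUpTo.refl (t s : ℝ) (u : ℝ → E) : AgreeUpTo t s u u :=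
  Filter.Eventually.of_forall fun _ => rfl

theorem AgreeUpTo.mono {s s' : ℝ} {u v : ℝ → E} (h : AgreeUpTo t s u v) (hs : s' ≤ s) :
    AgreeUpTo t s' u v :=
  ae_restrict_of_ae_restrict_of_subset (Icc_subset_Icc_right hs) h

/-- The endpoint is a null set, so signals switched at `s` still agree up to `s` in the closed
sense. -/
theorem AgreeUpTo.of_lt {s : ℝ} {u v : ℝ → E} (h : ∀ r, t ≤ r → r < s → u r = v r) :
    AgreeUpTo t s u v := by
  rw [AgreeUpTo, restrict_Ico_eq_restrict_Icc.symm, ae_restrict_iff' measurableSet_Ico]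
  exact Filter.Eventually.of_forall fun r hr => h r hr.1 hr.2

theorem AgreeUpTo.symm {s : ℝ} {u v : ℝ → E} (h : AgreeUpTo t s u v) : AgreeUpTo t s v u := by
  filter_upwards [h] with r hr using hr.symm

theorem AgreeUpTo.trans {s : ℝ} {u v w : ℝ → E} (h : AgreeUpTo t s u v)
    (h' : AgreeUpTo t s v w) : AgreeUpTo t s u w := by
  filter_upwards [h, h'] with r hr hr' using hr.trans hr'

end Agreement

section Signals

variable {E : Type*} [NormedAddCommGroup E] [MeasurableSpace E] [BorelSpace E]
  {U : Set E} {t T : ℝ}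

theorem aemeasurable_of_mem_controlSignals {u : ℝ → E} (hu : u ∈ controlSignals U t T) :
    AEMeasurable u (volume.restrict (Icc t T)) :=
  hu.2.1.aemeasurable

variable [SecondCountableTopology E]

theorem mem_controlSignals (hU : IsCompact U) {u : ℝ → E} (hu : ∀ s ∈ Icc t T, u s ∈ U)
    (hm : AEMeasurable u (volume.restrict (Icc t T))) : u ∈ controlSignals U t T := by
  obtain ⟨C, hC⟩ := hU.isBounded.exists_norm_le
  refine ⟨hu, memLp_top_of_bound hm.aestronglyMeasurable C ?_⟩
  filter_upwards [ae_restrict_mem measurableSet_Icc] with r hr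
  exact hC _ (hu r hr)

/-- The constant signal. -/
def constSignal (hU : IsCompact U) (t T : ℝ) (a : U) : controlSignals U t T :=
  ⟨fun _ => a, mem_controlSignals hU (fun _ _ => a.2) aemeasurable_const⟩

/-- The signal that follows `u` before the time `s₀` and `v` from then on. -/
def spliceSignal (hU : IsCompact U) (s₀ : ℝ) (u v : controlSignals U t T) :
    controlSignals U t T :=
  ⟨fun s => if s < s₀ then u.1 s else v.1 s, mem_controlSignals hU
    (fun s hs => by split_ifs; exacts [u.2.1 s hs, v.2.1 s hs])
    (AEStronglyMeasurable.piecewise (s := Iio s₀) measurableSet_Iio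
      u.2.2.1.restrict v.2.2.1.restrict).aemeasurable⟩

theorem spliceSignal_of_lt (hU : IsCompact U) {s₀ s : ℝ} (u v : controlSignals U t T)
    (h : s < s₀) : (spliceSignal hU s₀ u v).1 s = u.1 s :=
  if_pos h

theorem spliceSignal_of_le (hU : IsCompact U) {s₀ s : ℝ} (u v : controlSignals U t T)
    (h : s₀ ≤ s) : (spliceSignal hU s₀ u v).1 s = v.1 s :=
  if_neg h.not_gt

theorem AgreeUpTo.splice (hU : IsCompact U) {s s₀ : ℝ} {u u' v v' : controlSignals U t T}
    (h : AgreeUpTo t s (u : ℝ → E) u') (h' : AgreeUpTo t s (v : ℝ → E) v') :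
    AgreeUpTo t s (spliceSignal hU s₀ u v : ℝ → E) (spliceSignal hU s₀ u' v') := by
  filter_upwards [h, h'] with r hr hr'
  rcases lt_or_ge r s₀ with hlt | hle
  · rw [spliceSignal_of_lt _ _ _ hlt, spliceSignal_of_lt _ _ _ hlt, hr]
  · rw [spliceSignal_of_le _ _ _ hle, spliceSignal_of_le _ _ _ hle, hr']

theorem agreeUpTo_splice_left (hU : IsCompact U) {s s₀ : ℝ} (hs : s ≤ s₀)
    (u v : controlSignals U t T) : AgreeUpTo t s (spliceSignal hU s₀ u v : ℝ → E) u :=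
  AgreeUpTo.of_lt fun _ _ hr => spliceSignal_of_lt _ _ _ (hr.trans_le hs)

/-- The signal without freezing. -/
def unfrozen (t T : ℝ) : freezingSignals t T := constSignal isCompact_Icc t T ⟨1, by simp⟩

/-- The signal that freezes the game outside the order-connected set of times `S`. -/
def freezeOutside (t T : ℝ) (S : Set ℝ) (hS : S.OrdConnected) : freezingSignals t T :=
  ⟨S.indicator 1, mem_controlSignals isCompact_Icc
    (fun s _ => by by_cases h : s ∈ S <;> simp [h])
    ((measurable_one.indicator hS.measurableSet).aemeasurable)⟩

end Signals

section Responses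

variable {E F : Type*} [NormedAddCommGroup E] [NormedAddCommGroup F]
  [MeasurableSpace E] [BorelSpace E]
  [MeasurableSpace F] [BorelSpace F] [SecondCountableTopology F]
  {U : Set E} {W : Set F} {t T : ℝ}

/-- The instantaneous answer to the signal `u` by the measurable feedback `ψ`. -/
def responseSignal (hW : IsCompact W) (ψ : {ψ : E → F // Measurable ψ ∧ ∀ a, ψ a ∈ W})
    (u : controlSignals U t T) : controlSignals W t T :=
  ⟨fun s => ψ.1 (u.1 s), mem_controlSignals hW (fun _ _ => ψ.2.2 _)
    (ψ.2.1.comp_aemeasurable (aemeasurable_of_mem_controlSignals u.2))⟩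

theorem AgreeUpTo.response (hW : IsCompact W) (ψ : {ψ : E → F // Measurable ψ ∧ ∀ a, ψ a ∈ W})
    {s : ℝ} {u u' : controlSignals U t T} (h : AgreeUpTo t s (u : ℝ → E) u') :
    AgreeUpTo t s (responseSignal hW ψ u : ℝ → F) (responseSignal hW ψ u') := by
  filter_upwards [h] with r hr
  simp only [responseSignal, hr]

end Responses

/-! ### Trajectories of controlled, possibly frozen, fields. -/

section Trajectories

variable {V EA EB : Type*} [NormedAddCommGroup V] [NormedAddCommGroup EA] [NormedAddCommGroup EB]

/-- A controlled velocity field, with compact control sets, that is continuous and `K`-Lipschitz in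
the state. -/
structure IsGameField (A : Set EA) (B : Set EB) (F : V → EA → EB → V) (K : ℝ) : Prop where
  compact_A : IsCompact A
  compact_B : IsCompact B
  nonneg : 0 ≤ K
  lip : ∀ a ∈ A, ∀ b ∈ B, ∀ y y', ‖F y a b - F y' a b‖ ≤ K * ‖y - y'‖
  cont : ∀ y, ContinuousOn (fun w : EA × EB => F y w.1 w.2) (A ×ˢ B)

variable {A : Set EA} {B : Set EB} {F : V → EA → EB → V} {K : ℝ}

/-- The Lipschitz bound is uniform in the controls, which upgrades separate to joint continuity. -/
theorem IsGameField.continuousOn_uncurry (hF : IsGameField A B F K) :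
    ContinuousOn (fun w : V × EA × EB => F w.1 w.2.1 w.2.2) (univ ×ˢ A ×ˢ B) := by
  rintro ⟨y, a, b⟩ ⟨-, ha, hb⟩
  have h1 : Filter.Tendsto (fun w : V × EA × EB => F y w.2.1 w.2.2)
      (nhdsWithin (y, a, b) (univ ×ˢ A ×ˢ B)) (nhds (F y a b)) :=
    (hF.cont y (a, b) ⟨ha, hb⟩).tendsto.comp
      (tendsto_nhdsWithin_iff.2 ⟨(continuous_snd.tendsto (y, a, b)).mono_left nhdsWithin_le_nhds,
        by filter_upwards [self_mem_nhdsWithin] with w hw using hw.2⟩)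
  have h2 : Filter.Tendsto (fun w : V × EA × EB => K * ‖w.1 - y‖)
      (nhdsWithin (y, a, b) (univ ×ˢ A ×ˢ B)) (nhds 0) := by
    have : Continuous (fun w : V × EA × EB => K * ‖w.1 - y‖) := by fun_prop
    simpa using (this.tendsto (y, a, b)).mono_left nhdsWithin_le_nhds
  have h3 : Filter.Tendsto (fun w : V × EA × EB => F w.1 w.2.1 w.2.2 - F y w.2.1 w.2.2)
      (nhdsWithin (y, a, b) (univ ×ˢ A ×ˢ B)) (nhds 0) := by
    refine squeeze_zero_norm' ?_ h2
    filter_upwards [self_mem_nhdsWithin] with w hw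
    exact hF.lip _ hw.2.1 _ hw.2.2 _ _
  simpa [ContinuousWithinAt] using h3.add h1

theorem IsGameField.exists_bound (hF : IsGameField A B F K) (y : V) :
    ∃ M, 0 ≤ M ∧ ∀ a ∈ A, ∀ b ∈ B, ‖F y a b‖ ≤ M := by
  obtain ⟨C, hC⟩ := (hF.compact_A.prod hF.compact_B).exists_bound_of_continuousOn (hF.cont y)
  exact ⟨max C 0, le_max_right _ _, fun a ha b hb => (hC (a, b) ⟨ha, hb⟩).trans (le_max_left _ _)⟩

variable [NormedSpace ℝ V]

/-- The trajectory of the game frozen by `μ`. -/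
def traj (F : V → EA → EB → V) (t T : ℝ) (y₀ : V) (α : ℝ → EA) (β : ℝ → EB) (μ : ℝ → ℝ) : ℝ → V :=
  solution (fun s y => μ s • F y (α s) (β s)) t T y₀

variable [FiniteDimensional ℝ V] [MeasurableSpace V] [BorelSpace V]
  [MeasurableSpace EA] [BorelSpace EA] [SecondCountableTopology EA]
  [MeasurableSpace EB] [BorelSpace EB] [SecondCountableTopology EB]
  {t T : ℝ} {y₀ : V} {α α' : ℝ → EA} {β β' : ℝ → EB} {μ μ' : ℝ → ℝ}

theorem IsGameField.isCaratheodory (hF : IsGameField A B F K) (hα : α ∈ controlSignals A t T)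
    (hβ : β ∈ controlSignals B t T) (hμ : μ ∈ freezingSignals t T) {M : ℝ}
    (hM : ∀ a ∈ A, ∀ b ∈ B, ‖F y₀ a b‖ ≤ M) :
    IsCaratheodory (fun s y => μ s • F y (α s) (β s)) K M t T y₀ := by
  have hμ1 : ∀ s ∈ Icc t T, ‖μ s‖ ≤ 1 := fun s hs => by
    rw [Real.norm_eq_abs, abs_of_nonneg (hμ.1 s hs).1]; exact (hμ.1 s hs).2
  refine ⟨fun s hs y y' => ?_, fun y hy => ?_, fun s hs => ?_, hF.nonneg⟩
  · rw [← smul_sub, norm_smul]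
    exact (mul_le_of_le_one_left (norm_nonneg _) (hμ1 s hs)).trans
      (hF.lip _ (hα.1 s hs) _ (hβ.1 s hs) _ _)
  · classical
    have := FiniteDimensional.proper_real V
    have hS : MeasurableSet ((univ : Set V) ×ˢ A ×ˢ B) :=
      MeasurableSet.univ.prod (hF.compact_A.measurableSet.prod hF.compact_B.measurableSet)
    -- Extension by zero makes the field Borel on the whole product, and the signals never leave `A`
    -- and `B` on `[t, T]`.
    have h1 : Measurable (((univ : Set V) ×ˢ A ×ˢ B).piecewise
        (fun w => F w.1 w.2.1 w.2.2) (fun _ => 0)) :=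
      hF.continuousOn_uncurry.measurable_piecewise continuousOn_const hS
    have h2 : AEMeasurable (fun s => (y s, α s, β s)) (volume.restrict (Icc t T)) :=
      (hy.aemeasurable measurableSet_Icc).prodMk
        ((aemeasurable_of_mem_controlSignals hα).prodMk (aemeasurable_of_mem_controlSignals hβ))
    refine hμ.2.1.smul ((h1.comp_aemeasurable h2).aestronglyMeasurable.congr ?_)
    filter_upwards [ae_restrict_mem measurableSet_Icc] with s hs
    exact piecewise_eq_of_mem _ _ _ ⟨mem_univ _, hα.1 s hs, hβ.1 s hs⟩
  · rw [norm_smul]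
    exact (mul_le_of_le_one_left (norm_nonneg _) (hμ1 s hs)).trans (hM _ (hα.1 s hs) _ (hβ.1 s hs))

theorem IsGameField.isSolution_traj (hF : IsGameField A B F K) (htT : t ≤ T)
    (hα : α ∈ controlSignals A t T) (hβ : β ∈ controlSignals B t T)
    (hμ : μ ∈ freezingSignals t T) :
    IsSolution (fun s y => μ s • F y (α s) (β s)) t T y₀ (traj F t T y₀ α β μ) := by
  obtain ⟨M, -, hM⟩ := hF.exists_bound y₀
  exact (hF.isCaratheodory hα hβ hμ hM).isSolution_solution htT

theorem IsGameField.traj_eq (hF : IsGameField A B F K) (htT : t ≤ T)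
    (hα : α ∈ controlSignals A t T) (hβ : β ∈ controlSignals B t T)
    (hμ : μ ∈ freezingSignals t T) {y : ℝ → V}
    (hy : IsSolution (fun s y => μ s • F y (α s) (β s)) t T y₀ y) :
    EqOn y (traj F t T y₀ α β μ) (Icc t T) := by
  obtain ⟨M, -, hM⟩ := hF.exists_bound y₀
  exact (hF.isCaratheodory hα hβ hμ hM).eqOn hy (hF.isSolution_traj htT hα hβ hμ)

/-- On `[t, s]` both trajectories solve the same equation for almost every time, hence coincide. All
causality arguments below reduce to this. -/
theorem IsGameField.traj_congr (hF : IsGameField A B F K)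
    (hα : α ∈ controlSignals A t T) (hβ : β ∈ controlSignals B t T)
    (hμ : μ ∈ freezingSignals t T) (hα' : α' ∈ controlSignals A t T)
    (hβ' : β' ∈ controlSignals B t T) (hμ' : μ' ∈ freezingSignals t T) {s : ℝ}
    (hs : s ∈ Icc t T) (eα : AgreeUpTo t s α α') (eβ : AgreeUpTo t s β β')
    (eμ : AgreeUpTo t s μ μ') :
    EqOn (traj F t T y₀ α β μ) (traj F t T y₀ α' β' μ') (Icc t s) := by
  obtain ⟨M, -, hM⟩ := hF.exists_bound y₀
  have htT := hs.1.trans hs.2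
  have h1 := ((hF.isSolution_traj (y₀ := y₀) htT hα hβ hμ).of_restrict hs).congr_field
    (Ψ := fun s y => μ' s • F y (α' s) (β' s)) (by
      filter_upwards [eα, eβ, eμ] with r h1 h2 h3
      rw [h1, h2, h3]) hs.1
  exact ((hF.isCaratheodory hα' hβ' hμ' hM).mono hs).eqOn h1
    ((hF.isSolution_traj htT hα' hβ' hμ').of_restrict hs)

/-- All trajectories from `y₀` stay in a ball, where the velocities are bounded. -/
theorem IsGameField.exists_traj_bound (hF : IsGameField A B F K) (htT : t ≤ T) (y₀ : V) :
    ∃ R M : ℝ, 0 ≤ R ∧ 0 ≤ M ∧ ∀ α ∈ controlSignals A t T, ∀ β ∈ controlSignals B t T,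
      ∀ μ ∈ freezingSignals t T, ∀ s ∈ Icc t T, ‖traj F t T y₀ α β μ s - y₀‖ ≤ R ∧
        ∀ a ∈ A, ∀ b ∈ B, ‖F (traj F t T y₀ α β μ s) a b‖ ≤ M := by
  obtain ⟨M, hM0, hM⟩ := hF.exists_bound y₀
  have hR : 0 ≤ Real.exp ((2 * K + 1) * (T - t)) * (2 * (M * (T - t))) := by
    have := sub_nonneg.2 htT
    positivity
  refine ⟨Real.exp ((2 * K + 1) * (T - t)) * (2 * (M * (T - t))),
    M + K * (Real.exp ((2 * K + 1) * (T - t)) * (2 * (M * (T - t)))), hR,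
    add_nonneg hM0 (mul_nonneg hF.nonneg hR), fun α hα β hβ μ hμ s hs => ?_⟩
  have h1 := (hF.isCaratheodory hα hβ hμ hM).norm_sub_le (hF.isSolution_traj htT hα hβ hμ) hs
  refine ⟨h1, fun a ha b hb => ?_⟩
  have h2 := hF.lip a ha b hb (traj F t T y₀ α β μ s) y₀
  have h3 := hM a ha b hb
  have h4 := norm_sub_norm_le (F (traj F t T y₀ α β μ s) a b) (F y₀ a b)
  have h5 := mul_le_mul_of_nonneg_left h1 hF.nonneg
  linarith

end Trajectories

/-! ### Freezing imitates stopping: the two easy inequalities. -/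

section Costs

variable {V EA EB : Type*} [NormedAddCommGroup V] [NormedSpace ℝ V]
  [NormedAddCommGroup EA] [NormedAddCommGroup EB]

/-- The cost of the free-terminal-time game in terms of the augmented state. -/
def freeCost (F : V → EA → EB → V) (φ ψ : V → ℝ) (T t : ℝ) (y₀ : V) (α : ℝ → EA) (β : ℝ → EB) :
    EReal :=
  ⨆ τ ∈ Icc t T, max (⨆ s ∈ Icc t τ, ((φ (traj F t T y₀ α β (fun _ => 1) s) : ℝ) : EReal))
    ((ψ (traj F t T y₀ α β (fun _ => 1) τ) : ℝ) : EReal)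

/-- The cost of the fixed-terminal-time game with freezing control in terms of the augmented
state. -/
def fixedCost (F : V → EA → EB → V) (φ ψ : V → ℝ) (T t : ℝ) (y₀ : V) (α : ℝ → EA) (β : ℝ → EB)
    (μ : ℝ → ℝ) : EReal :=
  max (⨆ s ∈ Icc t T, ((φ (traj F t T y₀ α β μ s) : ℝ) : EReal))
    ((ψ (traj F t T y₀ α β μ T) : ℝ) : EReal)

variable [FiniteDimensional ℝ V] [MeasurableSpace V] [BorelSpace V]
  [MeasurableSpace EA] [BorelSpace EA] [SecondCountableTopology EA]
  [MeasurableSpace EB] [BorelSpace EB] [SecondCountableTopology EB]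
  {A : Set EA} {B : Set EB} {F : V → EA → EB → V} {K : ℝ} {φ ψ : V → ℝ}
  {t T : ℝ} {y₀ : V} {α α' : ℝ → EA} {β : ℝ → EB} {μ : ℝ → ℝ}

theorem one_mem_freezingSignals (t T : ℝ) : (fun _ => 1) ∈ freezingSignals t T :=
  (unfrozen t T).2

/-- Freezing the game at the time `τ` realizes the terminal time `τ`. -/
theorem IsGameField.le_fixedCost_of_freeze (hF : IsGameField A B F K)
    (hα : α ∈ controlSignals A t T) (hα' : α' ∈ controlSignals A t T)
    (hβ : β ∈ controlSignals B t T) (hμ : μ ∈ freezingSignals t T) {τ : ℝ} (hτ : τ ∈ Icc t T)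
    (eα : AgreeUpTo t τ α α') (h1 : ∀ s ∈ Icc t τ, μ s = 1) (h0 : ∀ s ∈ Ioc τ T, μ s = 0) :
    max (⨆ s ∈ Icc t τ, ((φ (traj F t T y₀ α β (fun _ => 1) s) : ℝ) : EReal))
      ((ψ (traj F t T y₀ α β (fun _ => 1) τ) : ℝ) : EReal) ≤ fixedCost F φ ψ T t y₀ α' β μ := by
  have htT := hτ.1.trans hτ.2
  have hY : EqOn (traj F t T y₀ α β (fun _ => 1)) (traj F t T y₀ α' β μ) (Icc t τ) :=
    hF.traj_congr hα hβ (one_mem_freezingSignals t T) hα' hβ hμ hτ eα (AgreeUpTo.refl _ _ _)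
      (AgreeUpTo.of_lt fun r hr hr' => (h1 r ⟨hr, hr'.le⟩).symm)
  -- After `τ` the velocity vanishes, so player A's signal there is immaterial; this is why `α'` has
  -- to match `α` only up to `τ`.
  have hT : traj F t T y₀ α' β μ T = traj F t T y₀ α' β μ τ := by
    rw [← sub_eq_zero, (hF.isSolution_traj htT hα' hβ hμ).sub_eq_integral hτ ⟨htT, le_rfl⟩]
    refine (intervalIntegral.integral_congr_ae (g := fun _ => 0) ?_).trans (by simp)
    refine Filter.Eventually.of_forall fun r hr => ?_
    rw [uIoc_of_le hτ.2] at hr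
    rw [h0 r hr, zero_smul]
  refine max_le_max ?_ ?_
  · refine iSup₂_le fun s hs => ?_
    rw [hY hs]
    exact le_iSup₂_of_le s ⟨hs.1, hs.2.trans hτ.2⟩ le_rfl
  · rw [hY ⟨hτ.1, le_rfl⟩, hT]

theorem IsGameField.continuousOn_traj (hF : IsGameField A B F K) (htT : t ≤ T)
    (hα : α ∈ controlSignals A t T) (hβ : β ∈ controlSignals B t T)
    (hμ : μ ∈ freezingSignals t T) : ContinuousOn (traj F t T y₀ α β μ) (Icc t T) :=
  (hF.isSolution_traj htT hα hβ hμ).1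

/-- If the free-terminal-time cost is at least `v`, there is a first time at which the running
maximum of the two cost functions reaches `v`. -/
theorem IsGameField.exists_isLeast_of_le_freeCost (hF : IsGameField A B F K) (hφ : Continuous φ)
    (hψ : Continuous ψ) (htT : t ≤ T) (hα : α ∈ controlSignals A t T)
    (hβ : β ∈ controlSignals B t T) {v : EReal} (hv : v ≤ freeCost F φ ψ T t y₀ α β) :
    ∃ τ, IsLeast {r ∈ Icc t T | v ≤ ((max (φ (traj F t T y₀ α β (fun _ => 1) r))
      (ψ (traj F t T y₀ α β (fun _ => 1) r)) : ℝ) : EReal)} τ := by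
  have hY := hF.continuousOn_traj (y₀ := y₀) htT hα hβ (one_mem_freezingSignals t T)
  set Z : ℝ → ℝ := fun r => max (φ (traj F t T y₀ α β (fun _ => 1) r))
      (ψ (traj F t T y₀ α β (fun _ => 1) r)) with hZ
  have hZc : ContinuousOn Z (Icc t T) := (hφ.comp_continuousOn hY).sup (hψ.comp_continuousOn hY)
  have hclosed : IsClosed (Icc t T ∩ (fun r => (Z r : EReal)) ⁻¹' Ici v) :=
    (continuous_coe_real_ereal.comp_continuousOn hZc).preimage_isClosed_of_isClosed isClosed_Icc
      isClosed_Ici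
  have hcompact : IsCompact (Icc t T ∩ (fun r => (Z r : EReal)) ⁻¹' Ici v) :=
    isCompact_Icc.of_isClosed_subset hclosed inter_subset_left
  obtain ⟨r₀, hr₀, hmax⟩ := isCompact_Icc.exists_isMaxOn (nonempty_Icc.2 htT) hZc
  have hle : freeCost F φ ψ T t y₀ α β ≤ (Z r₀ : EReal) := by
    refine iSup₂_le fun τ hτ => max_le (iSup₂_le fun s hs => ?_) ?_
    · exact EReal.coe_le_coe_iff.2 ((le_max_left _ _).trans (hmax ⟨hs.1, hs.2.trans hτ.2⟩))
    · exact EReal.coe_le_coe_iff.2 ((le_max_right _ _).trans (hmax hτ))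
  exact hcompact.exists_isLeast ⟨r₀, hr₀, hv.trans hle⟩

/-- The best stopping time depends on the future and is not available to a strategy. The first time
at which `φ` or `ψ` reaches the guaranteed value `v` depends on the past, and stopping there already
secures `v`. -/
theorem IsGameField.iSup_freeCost_le (hF : IsGameField A B F K) (hφ : Continuous φ)
    (hψ : Continuous ψ) (htT : t ≤ T) :
    (⨆ δ ∈ strategies A B t T, ⨅ α : controlSignals A t T, freeCost F φ ψ T t y₀ α (δ α)) ≤
      ⨆ δ ∈ strategies A B t T, ⨆ ν ∈ strategies A (Icc (0 : ℝ) 1) t T,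
        ⨅ α : controlSignals A t T, fixedCost F φ ψ T t y₀ α (δ α) (ν α) := by
  refine iSup₂_le fun δ hδ => le_iSup₂_of_le δ hδ ?_
  set v := ⨅ α : controlSignals A t T, freeCost F φ ψ T t y₀ α (δ α) with hv
  set Z : controlSignals A t T → ℝ → ℝ := fun α r =>
    max (φ (traj F t T y₀ α (δ α) (fun _ => 1) r))
      (ψ (traj F t T y₀ α (δ α) (fun _ => 1) r)) with hZ
  -- No hitting strictly before `r`: if `τ` is the first hitting time, this is the half-line up to
  -- and including `τ`. Membership of `r` depends on the trajectory before `r` only.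
  let S : controlSignals A t T → Set ℝ := fun α =>
    {r | ∀ r' ∈ Icc t T, r' < r → ¬ v ≤ (Z α r' : EReal)}
  have hS : ∀ α, (S α).OrdConnected := fun α =>
    ⟨fun x _ y hy r hr r' hr' hlt => hy r' hr' (hlt.trans_le hr.2)⟩
  refine le_iSup₂_of_le (fun α => freezeOutside t T (S α) (hS α)) ?_ (le_iInf fun α => ?_)
  · intro s hs u u' huu'
    have hZ' : EqOn (Z u) (Z u') (Icc t s) := fun r hr => by
      have := hF.traj_congr (y₀ := y₀) u.2 (δ u).2 (one_mem_freezingSignals t T) u'.2 (δ u').2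
        (one_mem_freezingSignals t T) hs huu' (hδ s hs u u' huu') (AgreeUpTo.refl _ _ _) hr
      simp only [hZ, this]
    refine AgreeUpTo.of_lt fun r _ hrs => ?_
    have : r ∈ S u ↔ r ∈ S u' := by
      refine forall₃_congr fun r' hr' hlt => ?_
      rw [hZ' ⟨hr'.1, (hlt.trans hrs).le⟩]
    by_cases h : r ∈ S u <;> simp [freezeOutside, h, this.1, ← this]
  · obtain ⟨τ, hτ, hleast⟩ := hF.exists_isLeast_of_le_freeCost hφ hψ htT α.2 (δ α).2
      (hv ▸ iInf_le _ α : v ≤ freeCost F φ ψ T t y₀ α (δ α))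
    refine le_trans ?_ (hF.le_fixedCost_of_freeze α.2 α.2 (δ α).2
      (freezeOutside t T (S α) (hS α)).2 hτ.1 (AgreeUpTo.refl _ _ _) ?_ ?_)
    · refine hτ.2.trans ?_
      rw [EReal.coe_strictMono.monotone.map_max]
      exact max_le_max (le_iSup₂_of_le τ ⟨hτ.1.1, le_rfl⟩ le_rfl) le_rfl
    · intro s hs
      exact indicator_of_mem (s := S α)
        (fun r' hr' hlt hle => absurd (hleast ⟨hr', hle⟩) (not_le.2 (hlt.trans_le hs.2))) _
    · intro s hs
      exact indicator_of_notMem (s := S α) (fun h => h τ hτ.1 hs.1 hτ.2) _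

/-- Player A reuses the answers given against the unfrozen signal. If B freezes after `τ`, A cannot
tell the difference up to `τ`, so B attains the cost of stopping at `τ`. -/
theorem IsGameField.iInf_freeCost_le (hF : IsGameField A B F K) :
    (⨅ γ ∈ strategies B A t T, ⨆ β : controlSignals B t T, freeCost F φ ψ T t y₀ (γ β) β) ≤
      ⨅ γ ∈ strategies₂ B (Icc (0 : ℝ) 1) A t T,
        ⨆ (β : controlSignals B t T) (μ : freezingSignals t T),
          fixedCost F φ ψ T t y₀ (γ (β, μ)) β μ := by
  refine le_iInf₂ fun γ hγ => iInf₂_le_of_le (fun β => γ (β, unfrozen t T)) ?_ ?_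
  · exact fun s hs u u' huu' => hγ s hs u u' _ _ huu' (AgreeUpTo.refl _ _ _)
  refine iSup_le fun β => le_iSup_of_le β (iSup₂_le fun τ hτ => ?_)
  let μ := freezeOutside t T (Iic τ) ordConnected_Iic
  have h1 : ∀ s ≤ τ, μ.1 s = 1 := fun s hs => indicator_of_mem (s := Iic τ) hs _
  refine le_iSup_of_le μ (hF.le_fixedCost_of_freeze (γ (β, unfrozen t T)).2 (γ (β, μ)).2 β.2
    μ.2 hτ ?_ (fun s hs => h1 s hs.2) ?_)
  · refine hγ τ hτ _ _ _ _ (AgreeUpTo.refl _ _ _) (AgreeUpTo.of_lt fun r _ hr => ?_)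
    exact (h1 r hr.le).symm
  · exact fun s hs => indicator_of_notMem (s := Iic τ) (not_le.2 hs.1) _

end Costs

/-! ### Extremal shift: the tracking estimate. -/

theorem discrete_gronwall {q : ℕ → ℝ} {a b : ℝ} (ha : 0 ≤ a) (hb : 0 ≤ b) {N : ℕ}
    (h0 : q 0 ≤ 0) (hstep : ∀ k < N, q (k + 1) ≤ (1 + a) * q k + b) :
    ∀ k ≤ N, q k ≤ Real.exp (a * k) * (k * b) := by
  intro k
  induction k with
  | zero => intro _; simpa using h0
  | succ k ih =>
    intro hk
    have h1 := hstep k hk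
    have h2 := mul_le_mul_of_nonneg_left (ih (Nat.le_of_succ_le hk)) (by positivity : 0 ≤ 1 + a)
    have h3 : 1 + a ≤ Real.exp a := by linarith [Real.add_one_le_exp a]
    have h4 : Real.exp (a * ((k + 1 : ℕ) : ℝ)) = Real.exp a * Real.exp (a * k) := by
      rw [← Real.exp_add]; push_cast; ring_nf
    have h5 : (1 + a) * (Real.exp (a * k) * (k * b)) ≤
        Real.exp a * (Real.exp (a * k) * (k * b)) := by gcongr
    have h6 : 1 * b ≤ Real.exp a * Real.exp (a * k) * b := by
      refine mul_le_mul_of_nonneg_right ?_ hb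
      rw [← Real.exp_add]
      exact Real.one_le_exp (by positivity)
    rw [h4]
    push_cast
    linarith

section Tracking

variable {V EA EB : Type*} [NormedAddCommGroup V] [NormedSpace ℝ V]

/-- Extremal shift with step `h` and accuracy `η`: `Y` is a motion of the frozen game with signals
`α', β'`, observed at the times `t + k h`, and `X` is a motion of the original game with signals
`α, β`, observed at the times `σ k`. During each step the velocity of `Y` in the direction
`Y (t + k h) - X (σ k)` is at most some `H`, and the one of `X` is at least `H` unless `H ≤ 0`, in
which case `X` waits. -/
structure IsExtremalShift (G : V →L[ℝ] V →L[ℝ] ℝ) (F : V → EA → EB → V) (t h : ℝ) (N : ℕ) (η : ℝ)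
    (X Y : ℝ → V) (α : ℝ → EA) (β : ℝ → EB) (α' : ℝ → EA) (β' : ℝ → EB) (σ : ℕ → ℝ) : Prop where
  start : σ 0 = t
  step : ∀ k < N, ∃ H : ℝ,
    (∀ s ∈ Ico (t + k * h) (t + k * h + h),
      G (Y (t + k * h) - X (σ k)) (F (X (σ k)) (α' s) (β' s)) ≤ H + η) ∧
    ((0 < H ∧ σ (k + 1) = σ k + h ∧ ∀ r ∈ Ico (σ k) (σ k + h),
        H - η ≤ G (Y (t + k * h) - X (σ k)) (F (X (σ k)) (α r) (β r))) ∨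
      (H ≤ 0 ∧ σ (k + 1) = σ k))

/-- During a step of length `h` the clock of `X` advances by `h` or stands still, so it never
overtakes that of `Y`. -/
theorem IsExtremalShift.mem_Icc {G : V →L[ℝ] V →L[ℝ] ℝ} {F : V → EA → EB → V} {t h : ℝ} {N : ℕ}
    {η : ℝ} {X Y : ℝ → V} {α : ℝ → EA} {β : ℝ → EB} {α' : ℝ → EA} {β' : ℝ → EB} {σ : ℕ → ℝ}
    (hS : IsExtremalShift G F t h N η X Y α β α' β' σ) (hh : 0 ≤ h) :
    ∀ k ≤ N, σ k ∈ Icc t (t + k * h) := by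
  intro k
  induction k with
  | zero => intro _; simp [hS.start]
  | succ k ih =>
    intro hk
    obtain ⟨h1, h2⟩ := ih (Nat.le_of_succ_le hk)
    obtain ⟨H, -, ⟨-, h3, -⟩ | ⟨-, h3⟩⟩ := hS.step k hk <;> rw [h3] <;> push_cast <;>
      constructor <;> linarith

variable [FiniteDimensional ℝ V] [MeasurableSpace V] [BorelSpace V]
  [NormedAddCommGroup EA] [NormedAddCommGroup EB]
  [MeasurableSpace EA] [BorelSpace EA] [SecondCountableTopology EA]
  [MeasurableSpace EB] [BorelSpace EB] [SecondCountableTopology EB]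
  {A : Set EA} {B : Set EB} {F : V → EA → EB → V} {K : ℝ} {φ ψ : V → ℝ}
  {t T : ℝ} {y₀ : V} {α α' : ℝ → EA} {β β' : ℝ → EB} {μ : ℝ → ℝ}
  {G : V →L[ℝ] V →L[ℝ] ℝ}

theorem IsGameField.norm_traj_sub_le (hF : IsGameField A B F K) (hα : α ∈ controlSignals A t T)
    (hβ : β ∈ controlSignals B t T) (hμ : μ ∈ freezingSignals t T) {M : ℝ}
    (hM : ∀ s ∈ Icc t T, ∀ a ∈ A, ∀ b ∈ B, ‖F (traj F t T y₀ α β μ s) a b‖ ≤ M) {a b : ℝ}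
    (ha : t ≤ a) (hab : a ≤ b) (hb : b ≤ T) :
    ‖traj F t T y₀ α β μ b - traj F t T y₀ α β μ a‖ ≤ M * (b - a) := by
  rw [(hF.isSolution_traj (ha.trans (hab.trans hb)) hα hβ hμ).sub_eq_integral
    ⟨ha, hab.trans hb⟩ ⟨ha.trans hab, hb⟩]
  rw [← abs_of_nonneg (sub_nonneg.2 hab)]
  refine intervalIntegral.norm_integral_le_of_norm_le_const fun r hr => ?_
  rw [uIoc_of_le hab] at hr
  have hr' : r ∈ Icc t T := ⟨ha.trans hr.1.le, hr.2.trans hb⟩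
  rw [norm_smul, Real.norm_eq_abs, abs_of_nonneg (hμ.1 r hr').1]
  exact (mul_le_of_le_one_left (norm_nonneg _) (hμ.1 r hr').2).trans
    (hM r hr' _ (hα.1 r hr') _ (hβ.1 r hr'))

/-- The increment of a trajectory in the direction `p`, when the velocities frozen at `x₀` are
bounded by `c` in this direction. -/
theorem IsGameField.traj_increment_le (hF : IsGameField A B F K) (hα : α ∈ controlSignals A t T)
    (hβ : β ∈ controlSignals B t T) (hμ : μ ∈ freezingSignals t T) {a b c e : ℝ} {p x₀ : V}
    (ha : t ≤ a) (hab : a ≤ b) (hb : b ≤ T)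
    (hc : ∀ s ∈ Ico a b, μ s * G p (F x₀ (α s) (β s)) ≤ c)
    (he : ∀ s ∈ Icc a b, ‖traj F t T y₀ α β μ s - x₀‖ ≤ e) :
    G p (traj F t T y₀ α β μ b - traj F t T y₀ α β μ a) ≤
      (b - a) * (c + ‖G‖ * ‖p‖ * (K * e)) := by
  have hsol := hF.isSolution_traj (y₀ := y₀) (ha.trans (hab.trans hb)) hα hβ hμ
  have hint : IntervalIntegrable (fun s => μ s • F (traj F t T y₀ α β μ s) (α s) (β s))
      volume a b := hsol.2.1.mono_set (by
    rw [uIcc_of_le hab, uIcc_of_le (ha.trans (hab.trans hb))]; exact Icc_subset_Icc ha hb)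
  rw [hsol.sub_eq_integral ⟨ha, hab.trans hb⟩ ⟨ha.trans hab, hb⟩,
    ← ContinuousLinearMap.intervalIntegral_comp_comm _ hint]
  have h1 : ∫ _ in a..b, (c + ‖G‖ * ‖p‖ * (K * e)) = (b - a) * (c + ‖G‖ * ‖p‖ * (K * e)) := by
    rw [intervalIntegral.integral_const, smul_eq_mul]
  rw [← h1]
  refine intervalIntegral.integral_mono_on_of_le_Ioo hab ?_ (by simp) fun s hs => ?_
  · exact ⟨(G p).integrable_comp hint.1, (G p).integrable_comp hint.2⟩
  have hs' : s ∈ Icc t T := ⟨ha.trans hs.1.le, hs.2.le.trans hb⟩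
  have h2 := hc s ⟨hs.1.le, hs.2⟩
  have h3 := he s ⟨hs.1.le, hs.2.le⟩
  have h4 := hF.lip _ (hα.1 s hs') _ (hβ.1 s hs') (traj F t T y₀ α β μ s) x₀
  have h5 := (le_abs_self _).trans (G.le_opNorm₂ p
    (F (traj F t T y₀ α β μ s) (α s) (β s) - F x₀ (α s) (β s)))
  have h6 : ‖G‖ * ‖p‖ * ‖F (traj F t T y₀ α β μ s) (α s) (β s) - F x₀ (α s) (β s)‖ ≤
      ‖G‖ * ‖p‖ * (K * e) := by
    have := hF.nonneg
    gcongr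
    exact h4.trans (by gcongr)
  have h7 : 0 ≤ ‖G‖ * ‖p‖ * (K * e) := (by positivity : (0:ℝ) ≤ _).trans h6
  have hμs := hμ.1 s hs'
  simp only [map_smul, smul_eq_mul]
  have h8 : G p (F (traj F t T y₀ α β μ s) (α s) (β s)) = G p (F x₀ (α s) (β s)) +
      G p (F (traj F t T y₀ α β μ s) (α s) (β s) - F x₀ (α s) (β s)) := by
    rw [map_sub]; ring
  rw [h8, mul_add]
  have h9 : μ s * G p (F (traj F t T y₀ α β μ s) (α s) (β s) - F x₀ (α s) (β s)) ≤
      μ s * (‖G‖ * ‖p‖ * (K * e)) := mul_le_mul_of_nonneg_left (h5.trans h6) hμs.1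
  have h10 : μ s * (‖G‖ * ‖p‖ * (K * e)) ≤ ‖G‖ * ‖p‖ * (K * e) := mul_le_of_le_one_left h7 hμs.2
  linarith

/-- The tracking estimate of the extremal shift. -/
theorem IsGameField.extremalShift_le (hF : IsGameField A B F K)
    (hsymm : ∀ v w, G v w = G w v) (hpos : ∀ v, ‖v‖ ^ 2 ≤ G v v)
    (hα : α ∈ controlSignals A t T) (hβ : β ∈ controlSignals B t T)
    (hα' : α' ∈ controlSignals A t T) (hβ' : β' ∈ controlSignals B t T)
    (hμ : μ ∈ freezingSignals t T) {R M : ℝ} (hR : 0 ≤ R) (hM : 0 ≤ M)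
    (hRM : ∀ α ∈ controlSignals A t T, ∀ β ∈ controlSignals B t T,
      ∀ μ ∈ freezingSignals t T, ∀ s ∈ Icc t T, ‖traj F t T y₀ α β μ s - y₀‖ ≤ R ∧
        ∀ a ∈ A, ∀ b ∈ B, ‖F (traj F t T y₀ α β μ s) a b‖ ≤ M)
    {h η : ℝ} (hh : 0 ≤ h) (hη : 0 ≤ η) {N : ℕ} (hN : t + N * h ≤ T) {σ : ℕ → ℝ}
    (hS : IsExtremalShift G F t h N η (traj F t T y₀ α β (fun _ => 1)) (traj F t T y₀ α' β' μ)
      α β α' β' σ) {k : ℕ} (hk : k ≤ N) :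
    ‖traj F t T y₀ α' β' μ (t + k * h) - traj F t T y₀ α β (fun _ => 1) (σ k)‖ ^ 2 ≤
      Real.exp (2 * ‖G‖ * K * h * k) *
        (k * (h * (4 * η + (8 * ‖G‖ * K * R * M + 4 * ‖G‖ * M ^ 2) * h))) := by
  have hK := hF.nonneg
  set X := traj F t T y₀ α β (fun _ => 1) with hX
  set Y := traj F t T y₀ α' β' μ with hY
  set q : ℕ → ℝ := fun k => G (Y (t + k * h) - X (σ k)) (Y (t + k * h) - X (σ k)) with hq
  have hnode : ∀ k ≤ N, t + k * h ∈ Icc t T := fun k hk =>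
    ⟨by have : 0 ≤ k * h := by positivity
        linarith,
     by have : (k : ℝ) * h ≤ N * h := by gcongr
        linarith⟩
  have hσ : ∀ k ≤ N, σ k ∈ Icc t T := fun k hk =>
    ⟨(hS.mem_Icc hh k hk).1, (hS.mem_Icc hh k hk).2.trans (hnode k hk).2⟩
  have htT : t ≤ T := (hσ 0 (Nat.zero_le _)).1.trans (hσ 0 (Nat.zero_le _)).2
  have h1mem := one_mem_freezingSignals t T
  refine (hpos _).trans (discrete_gronwall (q := q) (by positivity) (by positivity) ?_ ?_ k hk)
  · have h1 : Y t = y₀ := by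
      have := (hF.isSolution_traj (y₀ := y₀) htT hα' hβ' hμ).2.2 t ⟨le_rfl, htT⟩
      simpa using this
    have h2 : X t = y₀ := by
      have := (hF.isSolution_traj (y₀ := y₀) htT hα hβ h1mem).2.2 t ⟨le_rfl, htT⟩
      simpa using this
    simp [hq, hS.start, h1, h2]
  · intro k hk
    obtain ⟨H, hYs, hXs⟩ := hS.step k hk
    set p := Y (t + k * h) - X (σ k) with hp
    have hks := hnode k hk.le
    have hks' := hnode (k + 1) hk
    have hkσ := hσ k hk.le
    have hkσ' := hσ (k + 1) hk
    have hcast : t + ((k + 1 : ℕ) : ℝ) * h = t + k * h + h := by push_cast; ring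
    rw [hcast] at hks'
    have hYM := fun s hs => (hRM α' hα' β' hβ' μ hμ s hs).2
    have hXM := fun s hs => (hRM α hα β hβ _ h1mem s hs).2
    have hpR : ‖p‖ ≤ 2 * R := by
      have h1 := (hRM α' hα' β' hβ' μ hμ _ hks).1
      have h2 := (hRM α hα β hβ _ h1mem _ hkσ).1
      have h3 : p = (Y (t + k * h) - y₀) - (X (σ k) - y₀) := by rw [hp]; abel
      rw [h3]
      exact (norm_sub_le _ _).trans (by linarith)
    have hMh : 0 ≤ M * h := by positivity
    -- the motion of the frozen game
    have eY : G p (Y (t + k * h + h) - Y (t + k * h)) ≤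
        (t + k * h + h - (t + k * h)) *
          (max H 0 + η + ‖G‖ * ‖p‖ * (K * (‖p‖ + M * h))) := by
      refine hF.traj_increment_le hα' hβ' hμ (x₀ := X (σ k)) hks.1 (by linarith) hks'.2
        (fun s hs => ?_) (fun s hs => ?_)
      · have h1 := hμ.1 s ⟨hks.1.trans hs.1, hs.2.le.trans hks'.2⟩
        have h2 : G p (F (X (σ k)) (α' s) (β' s)) ≤ max H 0 + η :=
          (hYs s hs).trans (by gcongr; exact le_max_left _ _)
        -- Multiplication by `μ s ∈ [0, 1]` preserves an upper bound only if it is nonnegative;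
        -- hence `max H 0` instead of `H`.
        have h3 : 0 ≤ max H 0 + η := add_nonneg (le_max_right _ _) hη
        exact (mul_le_mul_of_nonneg_left h2 h1.1).trans (mul_le_of_le_one_left h3 h1.2)
      · have h1 := hF.norm_traj_sub_le hα' hβ' hμ hYM hks.1 hs.1 (hs.2.trans hks'.2)
        have h2 : Y s - X (σ k) = p + (Y s - Y (t + k * h)) := by rw [hp]; abel
        rw [← hY, h2]
        refine (norm_add_le _ _).trans (add_le_add le_rfl (h1.trans ?_))
        have := hs.2
        gcongr
        linarith
    have dY : ‖Y (t + k * h + h) - Y (t + k * h)‖ ≤ M * h := by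
      have := hF.norm_traj_sub_le hα' hβ' hμ hYM hks.1 (by linarith) hks'.2
      rwa [add_sub_cancel_left] at this
    rw [add_sub_cancel_left] at eY
    -- the motion of the original game
    have eX : -G p (X (σ (k + 1)) - X (σ k)) ≤
        h * (-max H 0 + η + ‖G‖ * ‖p‖ * (K * (M * h))) ∧
        ‖X (σ (k + 1)) - X (σ k)‖ ≤ M * h := by
      rcases hXs with ⟨hH, hnext, hr⟩ | ⟨hH, hnext⟩
      · rw [hnext] at hkσ' ⊢
        have h1 := hF.traj_increment_le (y₀ := y₀) (G := G) hα hβ h1mem (x₀ := X (σ k)) (p := -p)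
          (c := -max H 0 + η) (e := M * h) hkσ.1 (by linarith) hkσ'.2
          (fun s hs => ?_) (fun s hs => ?_)
        · rw [add_sub_cancel_left, norm_neg, map_neg] at h1
          refine ⟨h1, ?_⟩
          have := hF.norm_traj_sub_le (y₀ := y₀) hα hβ h1mem hXM hkσ.1 (by linarith) hkσ'.2
          rwa [add_sub_cancel_left] at this
        · have := hr s hs
          rw [max_eq_left hH.le, one_mul, map_neg, _root_.neg_apply]
          linarith
        · refine (hF.norm_traj_sub_le hα hβ h1mem hXM hkσ.1 hs.1 (hs.2.trans hkσ'.2)).trans ?_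
          have := hs.2
          gcongr
          linarith
      -- Waiting contributes zero, which matches `max H 0 = 0`.
      · rw [hnext, sub_self, map_zero, norm_zero, max_eq_right hH]
        exact ⟨by rw [neg_zero]; positivity, hMh⟩
    set dy := Y (t + k * h + h) - Y (t + k * h) with hdy
    set dx := X (σ (k + 1)) - X (σ k) with hdx
    have hnext : Y (t + ((k + 1 : ℕ) : ℝ) * h) - X (σ (k + 1)) = p + (dy - dx) := by
      rw [hcast, hp, hdy, hdx]; abel
    -- In the first-order part `max H 0` enters with opposite signs and cancels (`hsum`); the last
    -- term is of order `h ^ 2`.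
    have hquad : G (p + (dy - dx)) (p + (dy - dx)) =
        G p p + 2 * (G p dy + -G p dx) + G (dy - dx) (dy - dx) := by
      simp only [map_add, map_sub, _root_.add_apply, _root_.sub_apply,
        hsymm dy p, hsymm dx p]
      ring
    have hdd : G (dy - dx) (dy - dx) ≤ ‖G‖ * (2 * (M * h)) * (2 * (M * h)) := by
      refine (le_abs_self _).trans ((G.le_opNorm₂ _ _).trans ?_)
      have : ‖dy - dx‖ ≤ 2 * (M * h) := (norm_sub_le _ _).trans (by linarith [eX.2])
      gcongr
    -- Freezing the field of `Y` at `X (σ k)`, up to `‖p‖ + M h` away, costs a multiple of `‖p‖ ^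
    -- 2`. This term becomes the Gronwall growth factor.
    have hpp : ‖G‖ * K * ‖p‖ ^ 2 ≤ ‖G‖ * K * G p p := by gcongr; exact hpos p
    have hpR' : ‖G‖ * K * M * h * ‖p‖ ≤ ‖G‖ * K * M * h * (2 * R) := by gcongr
    have hsum : G p dy + -G p dx ≤
        h * (2 * η + ‖G‖ * K * G p p + 2 * (‖G‖ * K * M * h * (2 * R))) := by
      calc _ ≤ h * (max H 0 + η + ‖G‖ * ‖p‖ * (K * (‖p‖ + M * h))) +
            h * (-max H 0 + η + ‖G‖ * ‖p‖ * (K * (M * h))) := add_le_add eY eX.1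
        _ = h * (2 * η + ‖G‖ * K * ‖p‖ ^ 2 + 2 * (‖G‖ * K * M * h * ‖p‖)) := by ring
        _ ≤ _ := by gcongr
    have hqk : q (k + 1) = G (p + (dy - dx)) (p + (dy - dx)) := by
      rw [← hnext]
    rw [hqk, hquad]
    calc _ ≤ G p p + 2 * (h * (2 * η + ‖G‖ * K * G p p + 2 * (‖G‖ * K * M * h * (2 * R)))) +
          ‖G‖ * (2 * (M * h)) * (2 * (M * h)) := by gcongr
      _ = _ := by rw [show q k = G p p from rfl]; ring

end Tracking

/-! ### The static game played at each step. -/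

section Minimax

variable {EA EB : Type*} [TopologicalSpace EA] [T2Space EA] [MeasurableSpace EA] [BorelSpace EA]
  [TopologicalSpace EB] [SecondCountableTopology EB] [MeasurableSpace EB]
  {A : Set EA} {B : Set EB}

/-- An almost optimal choice of the minimizer, and an almost optimal measurable feedback of the
maximizer, in a static game in which the maximizer is informed of the choice of the minimizer. -/
theorem exists_static_minimax (hA : IsCompact A) (hB : IsCompact B) (hA' : A.Nonempty)
    (hB' : B.Nonempty) {φ : EA → EB → ℝ} (hφ : ContinuousOn (fun w : EA × EB => φ w.1 w.2) (A ×ˢ B))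
    {η : ℝ} (hη : 0 < η) :
    ∃ (H : ℝ) (a : A) (f : {f : EA → EB // Measurable f ∧ ∀ a, f a ∈ B}),
      (∀ b ∈ B, φ a b ≤ H + η) ∧ ∀ a ∈ A, H - η ≤ φ a (f.1 a) := by
  classical
  obtain ⟨C, hC⟩ := (hA.prod hB).exists_bound_of_continuousOn hφ
  have hC' : ∀ a ∈ A, ∀ b ∈ B, |φ a b| ≤ C := fun a ha b hb => hC (a, b) ⟨ha, hb⟩
  have hbdd : ∀ a ∈ A, BddAbove (φ a '' B) := fun a ha =>
    ⟨C, by rintro _ ⟨b, hb, rfl⟩; exact (abs_le.1 (hC' a ha b hb)).2⟩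
  set m : EA → ℝ := fun a => sSup (φ a '' B) with hm
  have hmbdd : BddBelow (m '' A) := by
    obtain ⟨b, hb⟩ := hB'
    refine ⟨-C, ?_⟩
    rintro _ ⟨a, ha, rfl⟩
    exact (abs_le.1 (hC' a ha b hb)).1.trans (le_csSup (hbdd a ha) ⟨b, hb, rfl⟩)
  set H := sInf (m '' A) with hH
  obtain ⟨_, ⟨a₀, ha₀, rfl⟩, hlt⟩ := exists_lt_of_csInf_lt (hA'.image m)
    (lt_add_of_pos_right H hη)
  have : Nonempty B := hB'.to_subtype
  let b : ℕ → B := TopologicalSpace.denseSeq B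
  -- By continuity some member of a dense sequence is almost optimal, and taking the first such
  -- index is a measurable choice. Off `A` the condition is vacuous and the index is `0`.
  have hex : ∀ a : EA, ∃ i, a ∈ A → H - η < φ a (b i) := by
    intro a
    by_cases ha : a ∈ A
    swap
    · exact ⟨0, fun h => absurd h ha⟩
    have h1 : H - η < m a := by
      have : H ≤ m a := csInf_le hmbdd ⟨a, ha, rfl⟩
      linarith
    obtain ⟨_, ⟨b', hb', rfl⟩, hb''⟩ := exists_lt_of_lt_csSup (hB'.image _) h1
    have hcont : Continuous fun b : B => φ a b :=
      hφ.comp_continuous (f := fun b : B => (a, (b : EB))) (by fun_prop) fun b => ⟨ha, b.2⟩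
    obtain ⟨i, hi⟩ := (TopologicalSpace.denseRange_denseSeq B).exists_mem_open
      (isOpen_lt continuous_const hcont) ⟨⟨b', hb'⟩, hb''⟩
    exact ⟨i, fun _ => hi⟩
  refine ⟨H, ⟨a₀, ha₀⟩, ⟨fun a => b (Nat.find (hex a)), ?_, fun a => (b _).2⟩, fun b' hb' => ?_,
    fun a ha => ?_⟩
  · have hfind : Measurable fun a => Nat.find (hex a) := by
      refine measurable_find hex fun i => ?_
      have hcont : ContinuousOn (fun a => φ a (b i)) A :=
        hφ.comp (f := fun a => (a, (b i : EB))) (by fun_prop) fun a ha => ⟨ha, (b i).2⟩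
      obtain ⟨u, hu, hu'⟩ := continuousOn_iff'.1 hcont (Ioi (H - η)) isOpen_Ioi
      have : {a | a ∈ A → H - η < φ a (b i)} =
          Aᶜ ∪ (fun a => φ a (b i)) ⁻¹' Ioi (H - η) ∩ A := by
        ext a
        by_cases ha : a ∈ A <;> simp [ha]
      rw [this, hu']
      exact hA.measurableSet.compl.union (hu.measurableSet.inter hA.measurableSet)
    exact measurable_subtype_coe.comp ((measurable_from_nat (f := b)).comp hfind)
  · exact (le_csSup (hbdd a₀ ha₀) ⟨b', hb', rfl⟩).trans hlt.le
  · exact (Nat.find_spec (hex a) ha).le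

end Minimax

/-! ### From tracking to costs: the choice of step and accuracy. -/

section CostComparison

variable {V EA EB : Type*} [NormedAddCommGroup V] [NormedSpace ℝ V]
  [FiniteDimensional ℝ V] [MeasurableSpace V] [BorelSpace V]
  [NormedAddCommGroup EA] [NormedAddCommGroup EB]
  [MeasurableSpace EA] [BorelSpace EA] [SecondCountableTopology EA]
  [MeasurableSpace EB] [BorelSpace EB] [SecondCountableTopology EB]
  {A : Set EA} {B : Set EB} {F : V → EA → EB → V} {K : ℝ} {φ ψ : V → ℝ}
  {t T : ℝ} {y₀ : V} {α α' : ℝ → EA} {β β' : ℝ → EB} {μ : ℝ → ℝ}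
  {G : V →L[ℝ] V →L[ℝ] ℝ}

theorem exists_node_near {t h : ℝ} {N : ℕ} {s : ℝ} (hs : t ≤ s) (hh : 0 ≤ h)
    (hsN : s ≤ t + N * h) : ∃ k ≤ N, t + k * h ≤ s ∧ s ≤ t + k * h + h := by
  induction N with
  | zero => exact ⟨0, le_rfl, by simpa using hs, by simp at hsN ⊢; linarith⟩
  | succ N ih =>
    rcases le_total s (t + N * h) with h1 | h1
    · obtain ⟨k, hk, h2⟩ := ih h1
      exact ⟨k, hk.trans (Nat.le_succ N), h2⟩
    · exact ⟨N, Nat.le_succ N, h1, by push_cast at hsN; linarith⟩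

/-- Extremal shift with sufficiently small parameters makes the cost of the frozen motion at most
the free-terminal-time cost of the original motion, up to `ε`. -/
theorem IsGameField.exists_fixedCost_le (hF : IsGameField A B F K) (htT : t ≤ T)
    (hsymm : ∀ v w, G v w = G w v) (hpos : ∀ v, ‖v‖ ^ 2 ≤ G v v) (y₀ : V)
    {C : ℝ} (hC : 0 < C) (hφ : ∀ v w, φ v ≤ φ w + C * ‖v - w‖) (hψ : ∀ v w, ψ v ≤ ψ w + C * ‖v - w‖)
    {ε : ℝ} (hε : 0 < ε) :
    ∃ (N : ℕ) (h η : ℝ), 0 < η ∧ 0 ≤ h ∧ t + N * h = T ∧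
      ∀ α ∈ controlSignals A t T, ∀ β ∈ controlSignals B t T,
      ∀ α' ∈ controlSignals A t T, ∀ β' ∈ controlSignals B t T,
      ∀ μ ∈ freezingSignals t T, ∀ σ : ℕ → ℝ,
      IsExtremalShift G F t h N η (traj F t T y₀ α β (fun _ => 1)) (traj F t T y₀ α' β' μ)
        α β α' β' σ →
      fixedCost F φ ψ T t y₀ α' β' μ ≤ freeCost F φ ψ T t y₀ α β + (ε : EReal) := by
  have hK := hF.nonneg
  obtain ⟨R, M, hR, hM, hRM⟩ := hF.exists_traj_bound htT y₀
  have hl : 0 ≤ T - t := sub_nonneg.2 htT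
  set D := Real.exp (2 * ‖G‖ * K * (T - t)) * (T - t) with hD
  have hD0 : 0 ≤ D := by positivity
  set P := 8 * ‖G‖ * K * R * M + 4 * ‖G‖ * M ^ 2 with hP
  have hP0 : 0 ≤ P := by positivity
  -- The tracking error at the nodes and the motion within a step are each at most `e`, and `C * (2
  -- * e) = ε`.
  set e := ε / (2 * C) with he
  have he0 : 0 < e := by positivity
  -- The tracking bound is at most `D * (4 * η + P * h)`; `η` and the second entry of `h₀` give each
  -- summand at most half of `e ^ 2`. The first entry of `h₀` gives `M * h ≤ e`.
  set η := e ^ 2 / (8 * (D + 1)) with hη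
  set h₀ := min (e / (M + 1)) (e ^ 2 / (2 * (D + 1) * (P + 1))) with hh₀
  have hh₀' : 0 < h₀ := lt_min (by positivity) (by positivity)
  obtain ⟨N, hN⟩ := exists_nat_gt ((T - t) / h₀)
  have hN0 : (0 : ℝ) < N := lt_of_le_of_lt (by positivity) hN
  set h := (T - t) / N with hh
  have hh0 : 0 ≤ h := by positivity
  have hhle : h ≤ h₀ := by
    rw [hh, div_le_iff₀ hN0, mul_comm]
    exact ((div_lt_iff₀ hh₀').1 hN).le
  have hNh : (N : ℝ) * h = T - t := by rw [hh]; field_simp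
  have hMh : M * h ≤ e := by
    have h1 : h ≤ e / (M + 1) := hhle.trans (min_le_left _ _)
    rw [le_div_iff₀ (by positivity)] at h1
    nlinarith
  have hω : D * (4 * η + P * h) ≤ e ^ 2 := by
    have h1 : h ≤ e ^ 2 / (2 * (D + 1) * (P + 1)) := hhle.trans (min_le_right _ _)
    rw [le_div_iff₀ (by positivity)] at h1
    have h2 : 8 * (D + 1) * η = e ^ 2 := by rw [hη]; field_simp
    have h3 : 0 ≤ D * h := by positivity
    have h4 : 0 ≤ P * h := by positivity
    have h5 : 0 < η := by positivity
    nlinarith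
  refine ⟨N, h, η, by positivity, hh0, by linarith, ?_⟩
  intro α hα β hβ α' hα' β' hβ' μ hμ σ hS
  have h1mem := one_mem_freezingSignals t T
  have htrack : ∀ k ≤ N, ‖traj F t T y₀ α' β' μ (t + k * h) -
      traj F t T y₀ α β (fun _ => 1) (σ k)‖ ≤ e := by
    intro k hk
    have hkh : k * h ≤ T - t := by
      rw [← hNh]; gcongr
    have h1 := hF.extremalShift_le hsymm hpos hα hβ hα' hβ' hμ hR hM hRM hh0
      (by positivity : 0 ≤ η) (by linarith) hS hk
    refine le_of_sq_le_sq (h1.trans (le_trans ?_ hω)) he0.le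
    have h2 : 0 ≤ 4 * η + P * h := by positivity
    calc _ = Real.exp (2 * ‖G‖ * K * (k * h)) * ((k * h) * (4 * η + P * h)) := by
          rw [hP]; ring_nf
      _ ≤ Real.exp (2 * ‖G‖ * K * (T - t)) * ((T - t) * (4 * η + P * h)) := by gcongr
      _ = _ := by rw [hD]; ring
  have hσ : ∀ k ≤ N, σ k ∈ Icc t T := fun k hk => by
    have h1 := hS.mem_Icc hh0 k hk
    have h2 : (k : ℝ) * h ≤ N * h := by gcongr
    exact ⟨h1.1, by linarith [h1.2]⟩
  have h2C : C * (2 * e) = ε := by rw [he]; field_simp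
  refine max_le (iSup₂_le fun s hs => ?_) ?_
  · obtain ⟨k, hk, hk1, hk2⟩ := exists_node_near hs.1 hh0 (by linarith [hs.2] : s ≤ t + N * h)
    have h1 : ‖traj F t T y₀ α' β' μ s - traj F t T y₀ α β (fun _ => 1) (σ k)‖ ≤ 2 * e := by
      have h2 := hF.norm_traj_sub_le (y₀ := y₀) hα' hβ' hμ
        (fun s hs => (hRM α' hα' β' hβ' μ hμ s hs).2)
        (by have : 0 ≤ k * h := by positivity
            linarith) hk1 hs.2
      have h3 : M * (s - (t + k * h)) ≤ M * h := by gcongr; linarith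
      have h4 := norm_sub_le_norm_sub_add_norm_sub (traj F t T y₀ α' β' μ s)
        (traj F t T y₀ α' β' μ (t + k * h)) (traj F t T y₀ α β (fun _ => 1) (σ k))
      linarith [htrack k hk]
    have h2 : φ (traj F t T y₀ α' β' μ s) ≤ φ (traj F t T y₀ α β (fun _ => 1) (σ k)) + ε := by
      refine (hφ _ (traj F t T y₀ α β (fun _ => 1) (σ k))).trans ?_
      rw [← h2C]
      gcongr
    refine (EReal.coe_le_coe_iff.2 h2).trans ?_
    rw [EReal.coe_add]
    gcongr
    exact le_iSup₂_of_le T ⟨htT, le_rfl⟩ (le_max_of_le_left (le_iSup₂_of_le (σ k) (hσ k hk) le_rfl))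
  · have h1 := htrack N le_rfl
    rw [show t + N * h = T by linarith] at h1
    have h2 : ψ (traj F t T y₀ α' β' μ T) ≤ ψ (traj F t T y₀ α β (fun _ => 1) (σ N)) + ε := by
      refine (hψ _ (traj F t T y₀ α β (fun _ => 1) (σ N))).trans ?_
      rw [← h2C]
      gcongr
      linarith
    refine (EReal.coe_le_coe_iff.2 h2).trans ?_
    rw [EReal.coe_add]
    gcongr
    -- The terminal state of `Y` is matched by stopping `X` at the time it has reached.
    exact le_iSup₂_of_le (σ N) (hσ N le_rfl) (le_max_right _ _)

end CostComparison

/-! ### Recursive construction of the extremal shift and its causality. -/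

section ShiftSchemes

variable {V EA EB : Type*} [NormedAddCommGroup V]
  [NormedAddCommGroup EA] [NormedAddCommGroup EB]
  [MeasurableSpace EA] [BorelSpace EA] [SecondCountableTopology EA]
  [MeasurableSpace EB] [BorelSpace EB] [SecondCountableTopology EB]
  {A : Set EA} {B : Set EB} {t T : ℝ}

/-- The state of the extremal shift: the time reached in the original game, the signal of player B
in the original game and the signal of player A in the frozen game. -/
abbrev ShiftState (A : Set EA) (B : Set EB) (t T : ℝ) : Type _ :=
  ℝ × controlSignals B t T × controlSignals A t T

/-- The data of an extremal shift: the motions of the original and of the frozen game as functions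
of the state, and a decision rule depending on the position in the original game and on the
direction. The original game advances when `value` is positive. -/
structure ShiftScheme (V : Type*) (A : Set EA) (B : Set EB) (t T : ℝ) where
  original : ShiftState A B t T → ℝ → V
  frozen : ShiftState A B t T → ℝ → V
  value : V → V → ℝ
  signalA : V → V → controlSignals A t T
  signalB : V → V → controlSignals B t T

namespace ShiftScheme

/-- The direction of the `k`-th step. -/
def direction (m : ShiftScheme V A B t T) (h : ℝ) (k : ℕ) (S : ShiftState A B t T) : V :=
  m.frozen S (t + k * h) - m.original S S.1

/-- One step of the extremal shift. -/
def step (m : ShiftScheme V A B t T) (hA : IsCompact A) (hB : IsCompact B) (h : ℝ) (k : ℕ)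
    (S : ShiftState A B t T) : ShiftState A B t T :=
  let x := m.original S S.1
  let p := m.direction h k S
  -- A decision is imposed on all later times and overwritten by the next splice, so it survives on
  -- its own step only. While `X` waits, B's signal is left untouched.
  if 0 < m.value x p then
    (S.1 + h, spliceSignal hB S.1 S.2.1 (m.signalB x p),
      spliceSignal hA (t + k * h) S.2.2 (m.signalA x p))
  else (S.1, S.2.1, spliceSignal hA (t + k * h) S.2.2 (m.signalA x p))

/-- The successive states of the extremal shift. -/
def run (m : ShiftScheme V A B t T) (hA : IsCompact A) (hB : IsCompact B) (h : ℝ)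
    (S₀ : ShiftState A B t T) : ℕ → ShiftState A B t T
  | 0 => S₀
  | k + 1 => m.step hA hB h k (run m hA hB h S₀ k)

variable (m : ShiftScheme V A B t T) (hA : IsCompact A) (hB : IsCompact B) {h : ℝ}
  (S₀ : ShiftState A B t T)

theorem step_snd_snd (k : ℕ) (S : ShiftState A B t T) :
    (m.step hA hB h k S).2.2 = spliceSignal hA (t + k * h) S.2.2
      (m.signalA (m.original S S.1) (m.direction h k S)) := by
  unfold step
  dsimp only
  split_ifs <;> rfl

theorem step_of_pos {k : ℕ} {S : ShiftState A B t T}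
    (hv : 0 < m.value (m.original S S.1) (m.direction h k S)) :
    (m.step hA hB h k S).1 = S.1 + h ∧ (m.step hA hB h k S).2.1 =
      spliceSignal hB S.1 S.2.1 (m.signalB (m.original S S.1) (m.direction h k S)) := by
  unfold step
  dsimp only
  rw [if_pos hv]
  exact ⟨rfl, rfl⟩

theorem step_of_nonpos {k : ℕ} {S : ShiftState A B t T}
    (hv : ¬ 0 < m.value (m.original S S.1) (m.direction h k S)) :
    (m.step hA hB h k S).1 = S.1 ∧ (m.step hA hB h k S).2.1 = S.2.1 := by
  unfold step
  dsimp only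
  rw [if_neg hv]
  exact ⟨rfl, rfl⟩

theorem le_step_fst (hh : 0 ≤ h) (k : ℕ) (S : ShiftState A B t T) :
    S.1 ≤ (m.step hA hB h k S).1 := by
  by_cases hv : 0 < m.value (m.original S S.1) (m.direction h k S)
  · rw [(m.step_of_pos hA hB hv).1]; linarith
  · rw [(m.step_of_nonpos hA hB hv).1]

theorem run_fst_mem_Icc (hh : 0 ≤ h) (hS₀ : S₀.1 = t) (k : ℕ) :
    (m.run hA hB h S₀ k).1 ∈ Icc t (t + k * h) := by
  induction k with
  | zero => simp [run, hS₀]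
  | succ k ih =>
    refine ⟨ih.1.trans (m.le_step_fst hA hB hh k _), ?_⟩
    have h1 : (m.run hA hB h S₀ (k + 1)).1 ≤ (m.run hA hB h S₀ k).1 + h := by
      change (m.step hA hB h k _).1 ≤ _
      by_cases hv : 0 < m.value (m.original (m.run hA hB h S₀ k) (m.run hA hB h S₀ k).1)
        (m.direction h k (m.run hA hB h S₀ k))
      · rw [(m.step_of_pos hA hB hv).1]
      · rw [(m.step_of_nonpos hA hB hv).1]; linarith
    push_cast
    linarith [ih.2]

/-- Later steps of the extremal shift do not change the past. -/
theorem run_stable (hh : 0 ≤ h) {k j : ℕ} (hkj : k ≤ j) :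
    (m.run hA hB h S₀ k).1 ≤ (m.run hA hB h S₀ j).1 ∧
    (∀ r < (m.run hA hB h S₀ k).1, (m.run hA hB h S₀ j).2.1.1 r = (m.run hA hB h S₀ k).2.1.1 r) ∧
    ∀ s < t + k * h, (m.run hA hB h S₀ j).2.2.1 s = (m.run hA hB h S₀ k).2.2.1 s := by
  induction j, hkj using Nat.le_induction with
  | base => exact ⟨le_rfl, fun _ _ => rfl, fun _ _ => rfl⟩
  | succ j hkj ih =>
    obtain ⟨h1, h2, h3⟩ := ih
    refine ⟨h1.trans (m.le_step_fst hA hB hh j _), fun r hr => ?_, fun s hs => ?_⟩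
    · rw [← h2 r hr]
      change (m.step hA hB h j _).2.1.1 r = _
      by_cases hv : 0 < m.value (m.original (m.run hA hB h S₀ j) (m.run hA hB h S₀ j).1)
        (m.direction h j (m.run hA hB h S₀ j))
      · rw [(m.step_of_pos hA hB hv).2, spliceSignal_of_lt _ _ _ (hr.trans_le h1)]
      · rw [(m.step_of_nonpos hA hB hv).2]
    · rw [← h3 s hs]
      change (m.step hA hB h j _).2.2.1 s = _
      rw [step_snd_snd, spliceSignal_of_lt]
      refine hs.trans_le ?_
      gcongr

/-- The motions of an extremal shift depend causally on the signals. -/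
structure IsCausal (m : ShiftScheme V A B t T) : Prop where
  original_congr : ∀ S S' : ShiftState A B t T, ∀ s ∈ Icc t T,
    AgreeUpTo t s (S.2.1 : ℝ → EB) S'.2.1 → m.original S s = m.original S' s
  frozen_congr : ∀ S S' : ShiftState A B t T, ∀ s ∈ Icc t T,
    AgreeUpTo t s (S.2.2 : ℝ → EA) S'.2.2 → m.frozen S s = m.frozen S' s

/-- Decisions were taken along the motions of stage `k`, while the conclusion concerns the final
ones. By `run_stable` and causality the two coincide at the node of stage `k`. -/
theorem isExtremalShift [NormedSpace ℝ V] (hm : m.IsCausal) (hh : 0 ≤ h) (hS₀ : S₀.1 = t) {N : ℕ}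
    (hN : t + N * h = T) {η : ℝ} {G : V →L[ℝ] V →L[ℝ] ℝ} {F : V → EA → EB → V}
    {α : ℝ → EA} {β : ℝ → EB}
    (hsA : ∀ x p, ∀ s ∈ Icc t T, G p (F x ((m.signalA x p).1 s) (β s)) ≤ m.value x p + η)
    (hsB : ∀ x p, ∀ s ∈ Icc t T, m.value x p - η ≤ G p (F x (α s) ((m.signalB x p).1 s))) :
    IsExtremalShift G F t h N η (m.original (m.run hA hB h S₀ N)) (m.frozen (m.run hA hB h S₀ N))
      α (m.run hA hB h S₀ N).2.1 (m.run hA hB h S₀ N).2.2 β fun k => (m.run hA hB h S₀ k).1 := by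
  refine ⟨hS₀, fun k hk => ?_⟩
  have hstab := m.run_stable hA hB S₀ hh hk.le
  have hstab' := m.run_stable hA hB S₀ hh (Nat.succ_le_of_lt hk)
  have hσ := m.run_fst_mem_Icc hA hB S₀ hh hS₀ k
  have hσ' := m.run_fst_mem_Icc hA hB S₀ hh hS₀ (k + 1)
  have hkN : t + (k : ℝ) * h + h ≤ T := by
    have : ((k + 1 : ℕ) : ℝ) * h ≤ N * h := by gcongr; exact hk
    push_cast at this
    linarith
  have hk0 : 0 ≤ (k : ℝ) * h := by positivity
  set S := m.run hA hB h S₀ k with hS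
  set S' := m.run hA hB h S₀ N with hS'
  have hnext : m.run hA hB h S₀ (k + 1) = m.step hA hB h k S := rfl
  rw [hnext] at hstab' hσ'
  push_cast at hstab' hσ'
  have hX : m.original S' S.1 = m.original S S.1 :=
    hm.original_congr _ _ _ ⟨hσ.1, by linarith [hσ.2]⟩ (AgreeUpTo.of_lt fun r _ hr => hstab.2.1 r hr)
  have hY : m.frozen S' (t + k * h) = m.frozen S (t + k * h) :=
    hm.frozen_congr _ _ _ ⟨by linarith, by linarith⟩
      (AgreeUpTo.of_lt fun r _ hr => hstab.2.2 r hr)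
  have hp : m.frozen S (t + k * h) - m.original S S.1 = m.direction h k S := rfl
  rw [hX, hY, hp, hnext]
  refine ⟨m.value (m.original S S.1) (m.direction h k S), fun s hs => ?_, ?_⟩
  · rw [hstab'.2.2 s (by linarith [hs.2]), step_snd_snd, spliceSignal_of_le _ _ _ hs.1]
    exact hsA _ _ s ⟨by linarith [hs.1], by linarith [hs.2]⟩
  · by_cases hv : 0 < m.value (m.original S S.1) (m.direction h k S)
    · have hst := m.step_of_pos hA hB hv
      refine Or.inl ⟨hv, hst.1, fun r hr => ?_⟩
      rw [hst.1] at hstab' hσ'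
      rw [hstab'.2.1 r hr.2, hst.2, spliceSignal_of_le _ _ _ hr.1]
      exact hsB _ _ r ⟨hσ.1.trans hr.1, by linarith [hr.2, hσ'.2]⟩
    · exact Or.inr ⟨not_lt.1 hv, (m.step_of_nonpos hA hB hv).1⟩

theorem agreeUpTo_step_of_le {r : ℝ} (k : ℕ) {S : ShiftState A B t T} (hr : r ≤ S.1) :
    AgreeUpTo t r ((m.step hA hB h k S).2.1 : ℝ → EB) S.2.1 := by
  by_cases hv : 0 < m.value (m.original S S.1) (m.direction h k S)
  · rw [(m.step_of_pos hA hB hv).2]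
    exact agreeUpTo_splice_left hB hr _ _
  · rw [(m.step_of_nonpos hA hB hv).2]
    exact AgreeUpTo.refl _ _ _

/-- Two extremal shifts in which the signals of player A in the original game and the answers of
player B agree up to the time `r`. -/
theorem run_agree_B {m m' : ShiftScheme V A B t T} (hA : IsCompact A) (hB : IsCompact B)
    {S₀ : ShiftState A B t T} (hh : 0 ≤ h) {r : ℝ}
    (hS₀ : S₀.1 = t) {N : ℕ} (hN : t + N * h = T)
    (horig : ∀ S S' : ShiftState A B t T, ∀ s ∈ Icc t T, s ≤ r →
      AgreeUpTo t s (S.2.1 : ℝ → EB) S'.2.1 → m.original S s = m'.original S' s)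
    (hfroz : ∀ S S' : ShiftState A B t T, S.2.2 = S'.2.2 → m.frozen S = m'.frozen S')
    (hval : m.value = m'.value) (hsA : m.signalA = m'.signalA)
    (hsB : ∀ x p, AgreeUpTo t r (m.signalB x p : ℝ → EB) (m'.signalB x p)) {k : ℕ} (hk : k ≤ N) :
    AgreeUpTo t r ((m.run hA hB h S₀ k).2.1 : ℝ → EB) (m'.run hA hB h S₀ k).2.1 ∧
      (((m.run hA hB h S₀ k).1 = (m'.run hA hB h S₀ k).1 ∧
          (m.run hA hB h S₀ k).2.2 = (m'.run hA hB h S₀ k).2.2) ∨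
        (r ≤ (m.run hA hB h S₀ k).1 ∧ r ≤ (m'.run hA hB h S₀ k).1)) := by
  induction k with
  | zero => exact ⟨AgreeUpTo.refl _ _ _, Or.inl ⟨rfl, rfl⟩⟩
  | succ k ih =>
    obtain ⟨hβ, hcase⟩ := ih (Nat.le_of_succ_le hk)
    have hσ := m.run_fst_mem_Icc hA hB S₀ hh hS₀ k
    have hkN : (k : ℝ) * h ≤ N * h := by gcongr; exact Nat.le_of_succ_le hk
    change AgreeUpTo t r ((m.step hA hB h k _).2.1 : ℝ → EB) (m'.step hA hB h k _).2.1 ∧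
      (((m.step hA hB h k _).1 = (m'.step hA hB h k _).1 ∧
        (m.step hA hB h k _).2.2 = (m'.step hA hB h k _).2.2) ∨
        (r ≤ (m.step hA hB h k _).1 ∧ r ≤ (m'.step hA hB h k _).1))
    set S := m.run hA hB h S₀ k
    set S' := m'.run hA hB h S₀ k
    -- Once both clocks have passed `r`, all further splices of B's signal happen after `r`, so its
    -- part on `[t, r]` is final even if the runs separate.
    have late : r ≤ S.1 → r ≤ S'.1 →
        AgreeUpTo t r ((m.step hA hB h k S).2.1 : ℝ → EB) (m'.step hA hB h k S').2.1 ∧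
          (r ≤ (m.step hA hB h k S).1 ∧ r ≤ (m'.step hA hB h k S').1) := fun h1 h2 =>
      ⟨(m.agreeUpTo_step_of_le hA hB k h1).trans
        (hβ.trans (m'.agreeUpTo_step_of_le hA hB k h2).symm),
        h1.trans (m.le_step_fst hA hB hh k S), h2.trans (m'.le_step_fst hA hB hh k S')⟩
    rcases hcase with ⟨h1, h2⟩ | ⟨h1, h2⟩
    swap
    · exact ⟨(late h1 h2).1, Or.inr (late h1 h2).2⟩
    rcases le_total r S.1 with hr | hr
    · exact ⟨(late hr (h1 ▸ hr)).1, Or.inr (late hr (h1 ▸ hr)).2⟩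
    have hx : m.original S S.1 = m'.original S' S'.1 := by
      rw [← h1]
      exact horig S S' _ ⟨hσ.1, by linarith [hσ.2]⟩ hr (hβ.mono hr)
    -- The frozen motion is needed at `t + k * h`, possibly beyond `r`. The induction therefore
    -- carries equality of the frozen signals, not mere agreement up to `r`.
    have hp : m.direction h k S = m'.direction h k S' := by
      rw [direction, direction, hx, hfroz S S' h2]
    have hα : (m.step hA hB h k S).2.2 = (m'.step hA hB h k S').2.2 := by
      rw [step_snd_snd, step_snd_snd, hx, hp, h2, hsA]
    by_cases hv : 0 < m.value (m.original S S.1) (m.direction h k S)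
    · have hv' : 0 < m'.value (m'.original S' S'.1) (m'.direction h k S') := by
        rwa [← hx, ← hp, ← hval]
      obtain ⟨e1, e2⟩ := m.step_of_pos hA hB hv
      obtain ⟨e1', e2'⟩ := m'.step_of_pos hA hB hv'
      refine ⟨?_, Or.inl ⟨by rw [e1, e1', h1], hα⟩⟩
      rw [e2, e2', ← hx, ← hp, ← h1]
      exact hβ.splice hB (hsB _ _)
    · have hv' : ¬ 0 < m'.value (m'.original S' S'.1) (m'.direction h k S') := by
        rwa [← hx, ← hp, ← hval]
      obtain ⟨e1, e2⟩ := m.step_of_nonpos hA hB hv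
      obtain ⟨e1', e2'⟩ := m'.step_of_nonpos hA hB hv'
      refine ⟨?_, Or.inl ⟨by rw [e1, e1', h1], hα⟩⟩
      rwa [e2, e2']

/-- Two extremal shifts in which the signals of player B and the freezing signals in the frozen
game and the answers of player A agree up to the time `r`. -/
theorem run_agree_A {m m' : ShiftScheme V A B t T} (hA : IsCompact A) (hB : IsCompact B)
    {S₀ : ShiftState A B t T} (hh : 0 ≤ h) {r : ℝ} {N : ℕ} (hN : t + N * h = T)
    (horig : ∀ S S' : ShiftState A B t T, S.2.1 = S'.2.1 → m.original S = m'.original S')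
    (hfroz : ∀ S S' : ShiftState A B t T, ∀ s ∈ Icc t T, s ≤ r →
      AgreeUpTo t s (S.2.2 : ℝ → EA) S'.2.2 → m.frozen S s = m'.frozen S' s)
    (hval : m.value = m'.value) (hsB : m.signalB = m'.signalB)
    (hsA : ∀ x p, AgreeUpTo t r (m.signalA x p : ℝ → EA) (m'.signalA x p)) {k : ℕ} (hk : k ≤ N) :
    AgreeUpTo t r ((m.run hA hB h S₀ k).2.2 : ℝ → EA) (m'.run hA hB h S₀ k).2.2 ∧
      (t + k * h ≤ r → (m.run hA hB h S₀ k).1 = (m'.run hA hB h S₀ k).1 ∧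
        (m.run hA hB h S₀ k).2.1 = (m'.run hA hB h S₀ k).2.1) := by
  induction k with
  | zero => exact ⟨AgreeUpTo.refl _ _ _, fun _ => ⟨rfl, rfl⟩⟩
  | succ k ih =>
    obtain ⟨hα, hcase⟩ := ih (Nat.le_of_succ_le hk)
    have hk0 : 0 ≤ (k : ℝ) * h := by positivity
    have hkN : (k : ℝ) * h ≤ N * h := by gcongr; exact Nat.le_of_succ_le hk
    change AgreeUpTo t r ((m.step hA hB h k _).2.2 : ℝ → EA) (m'.step hA hB h k _).2.2 ∧
      (_ → (m.step hA hB h k _).1 = (m'.step hA hB h k _).1 ∧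
        (m.step hA hB h k _).2.1 = (m'.step hA hB h k _).2.1)
    set S := m.run hA hB h S₀ k
    set S' := m'.run hA hB h S₀ k
    -- Beyond `r` player A's signal on `[t, r]` is final. Up to `r` every decision uses the frozen
    -- motion at a time `≤ r` and a wholly simulated original game, so the clocks and B's signals
    -- are equal.
    rcases le_or_gt (t + k * h) r with hr | hr
    swap
    · refine ⟨?_, fun hr' => ?_⟩
      · rw [step_snd_snd, step_snd_snd]
        exact (agreeUpTo_splice_left hA hr.le _ _).trans
          (hα.trans (agreeUpTo_splice_left hA hr.le _ _).symm)
      · push_cast at hr'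
        linarith
    obtain ⟨h1, h2⟩ := hcase hr
    have hx : m.original S S.1 = m'.original S' S'.1 := by rw [h1, horig S S' h2]
    have hp : m.direction h k S = m'.direction h k S' := by
      rw [direction, direction, hx,
        hfroz S S' _ ⟨by linarith, by linarith⟩ hr (hα.mono hr)]
    refine ⟨?_, fun _ => ?_⟩
    · rw [step_snd_snd, step_snd_snd, ← hx, ← hp]
      exact hα.splice hA (hsA _ _)
    by_cases hv : 0 < m.value (m.original S S.1) (m.direction h k S)
    · have hv' : 0 < m'.value (m'.original S' S'.1) (m'.direction h k S') := by
        rwa [← hx, ← hp, ← hval]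
      obtain ⟨e1, e2⟩ := m.step_of_pos hA hB hv
      obtain ⟨e1', e2'⟩ := m'.step_of_pos hA hB hv'
      rw [e1, e1', e2, e2', hx, hp, h1, h2, hsB]
      exact ⟨rfl, rfl⟩
    · have hv' : ¬ 0 < m'.value (m'.original S' S'.1) (m'.direction h k S') := by
        rwa [← hx, ← hp, ← hval]
      obtain ⟨e1, e2⟩ := m.step_of_nonpos hA hB hv
      obtain ⟨e1', e2'⟩ := m'.step_of_nonpos hA hB hv'
      rw [e1, e1', e2, e2', h1, h2]
      exact ⟨rfl, rfl⟩

end ShiftScheme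

end ShiftSchemes

/-! ### Transfer of strategies between the games and the hard inequalities. -/

section Values

variable {V EA EB : Type*} [NormedAddCommGroup V] [NormedSpace ℝ V]
  [FiniteDimensional ℝ V] [MeasurableSpace V] [BorelSpace V]
  [NormedAddCommGroup EA] [NormedAddCommGroup EB]
  [MeasurableSpace EA] [BorelSpace EA] [SecondCountableTopology EA]
  [MeasurableSpace EB] [BorelSpace EB] [SecondCountableTopology EB]
  {A : Set EA} {B : Set EB} {F : V → EA → EB → V} {K : ℝ} {φ ψ : V → ℝ}
  {t T : ℝ} {y₀ : V} {G : V →L[ℝ] V →L[ℝ] ℝ} {C : ℝ}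

/-- Player B can transfer a strategy with freezing to the original game, up to `ε`. -/
theorem IsGameField.exists_strategy_original (hF : IsGameField A B F K) (htT : t ≤ T)
    (hsymm : ∀ v w, G v w = G w v) (hpos : ∀ v, ‖v‖ ^ 2 ≤ G v v) (hC : 0 < C)
    (hφ : ∀ v w, φ v ≤ φ w + C * ‖v - w‖) (hψ : ∀ v w, ψ v ≤ ψ w + C * ‖v - w‖)
    (hA : A.Nonempty) (hB : B.Nonempty) {δ : controlSignals A t T → controlSignals B t T}
    (hδ : δ ∈ strategies A B t T) {ν : controlSignals A t T → freezingSignals t T}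
    (hν : ν ∈ strategies A (Icc (0 : ℝ) 1) t T) {ε : ℝ} (hε : 0 < ε) :
    ∃ δ' ∈ strategies A B t T, ∀ α : controlSignals A t T, ∃ α' : controlSignals A t T,
      fixedCost F φ ψ T t y₀ α' (δ α') (ν α') ≤ freeCost F φ ψ T t y₀ α (δ' α) + (ε : EReal) := by
  obtain ⟨N, h, η, hη, hh, hN, hcost⟩ := hF.exists_fixedCost_le htT hsymm hpos y₀ hC hφ hψ hε
  have key : ∀ x p : V, ∃ (H : ℝ) (a : A) (f : {f : EA → EB // Measurable f ∧ ∀ a, f a ∈ B}),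
      (∀ b ∈ B, G p (F x a b) ≤ H + η) ∧ ∀ a ∈ A, H - η ≤ G p (F x a (f.1 a)) := fun x p =>
    exists_static_minimax hF.compact_A hF.compact_B hA hB (φ := fun a b => G p (F x a b))
      ((G p).continuous.comp_continuousOn (hF.cont x)) hη
  choose H a f hle hge using key
  have h1mem := one_mem_freezingSignals t T
  -- The actual opponent plays `α` in the original game, where B answers it by feedback. In the
  -- frozen game A is simulated, against `δ` and `ν`, by piecewise constant almost optimal choices.
  let m : controlSignals A t T → ShiftScheme V A B t T := fun α =>
    { original := fun S => traj F t T y₀ α S.2.1 (fun _ => 1)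
      frozen := fun S => traj F t T y₀ S.2.2 (δ S.2.2) (ν S.2.2)
      value := H
      signalA := fun x p => constSignal hF.compact_A t T (a x p)
      signalB := fun x p => responseSignal hF.compact_B (f x p) α }
  obtain ⟨a₀, ha₀⟩ := hA
  obtain ⟨b₀, hb₀⟩ := hB
  let S₀ : ShiftState A B t T :=
    (t, constSignal hF.compact_B t T ⟨b₀, hb₀⟩, constSignal hF.compact_A t T ⟨a₀, ha₀⟩)
  let S : controlSignals A t T → ShiftState A B t T := fun α =>
    (m α).run hF.compact_A hF.compact_B h S₀ N
  refine ⟨fun α => (S α).2.1, fun r hr α₁ α₂ hα => ?_, fun α => ⟨(S α).2.2, ?_⟩⟩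
  · refine (ShiftScheme.run_agree_B (m := m α₁) (m' := m α₂) hF.compact_A hF.compact_B (S₀ := S₀)
      hh rfl hN (fun S S' s hs hsr hagree => ?_) (fun S S' hS => ?_) rfl rfl
      (fun x p => hα.response hF.compact_B (f x p)) le_rfl).1
    · exact hF.traj_congr α₁.2 S.2.1.2 h1mem α₂.2 S'.2.1.2 h1mem hs (hα.mono hsr) hagree
        (AgreeUpTo.refl _ _ _) ⟨hs.1, le_rfl⟩
    · simp only [m, hS]
  · have hm : (m α).IsCausal :=
      ⟨fun S S' s hs hagree => hF.traj_congr α.2 S.2.1.2 h1mem α.2 S'.2.1.2 h1mem hs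
        (AgreeUpTo.refl _ _ _) hagree (AgreeUpTo.refl _ _ _) ⟨hs.1, le_rfl⟩,
      fun S S' s hs hagree => hF.traj_congr S.2.2.2 (δ S.2.2).2 (ν S.2.2).2 S'.2.2.2
        (δ S'.2.2).2 (ν S'.2.2).2 hs hagree (hδ s hs _ _ hagree) (hν s hs _ _ hagree)
        ⟨hs.1, le_rfl⟩⟩
    exact hcost α α.2 _ (S α).2.1.2 _ (S α).2.2.2 _ (δ (S α).2.2).2 _ (ν (S α).2.2).2 _
      ((m α).isExtremalShift hF.compact_A hF.compact_B S₀ hm hh rfl hN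
        (fun x p s hs => hle x p _ ((δ (S α).2.2).2.1 s hs))
        (fun x p s hs => hge x p _ (α.2.1 s hs)))

/-- Player A can transfer a strategy for the original game to the frozen game, up to `ε`. -/
theorem IsGameField.exists_strategy_frozen (hF : IsGameField A B F K) (htT : t ≤ T)
    (hsymm : ∀ v w, G v w = G w v) (hpos : ∀ v, ‖v‖ ^ 2 ≤ G v v) (hC : 0 < C)
    (hφ : ∀ v w, φ v ≤ φ w + C * ‖v - w‖) (hψ : ∀ v w, ψ v ≤ ψ w + C * ‖v - w‖)
    (hA : A.Nonempty) (hB : B.Nonempty) {γ : controlSignals B t T → controlSignals A t T}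
    (hγ : γ ∈ strategies B A t T) {ε : ℝ} (hε : 0 < ε) :
    ∃ γ' ∈ strategies₂ B (Icc (0 : ℝ) 1) A t T,
      ∀ (β : controlSignals B t T) (μ : freezingSignals t T), ∃ β' : controlSignals B t T,
      fixedCost F φ ψ T t y₀ (γ' (β, μ)) β μ ≤ freeCost F φ ψ T t y₀ (γ β') β' + (ε : EReal) := by
  obtain ⟨N, h, η, hη, hh, hN, hcost⟩ := hF.exists_fixedCost_le htT hsymm hpos y₀ hC hφ hψ hε
  have key : ∀ x p : V, ∃ (H : ℝ) (b : B) (f : {f : EB → EA // Measurable f ∧ ∀ b, f b ∈ A}),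
      (∀ a ∈ A, H - η ≤ G p (F x a b)) ∧ ∀ b ∈ B, G p (F x (f.1 b) b) ≤ H + η := by
    intro x p
    -- Changing the sign of the payoff exchanges the roles: B commits and A is informed.
    obtain ⟨H, b, f, h1, h2⟩ := exists_static_minimax hF.compact_B hF.compact_A hB hA
      (φ := fun b a => -G p (F x a b))
      ((G p).continuous.comp_continuousOn ((hF.cont x).comp (continuous_swap.continuousOn)
        fun w hw => ⟨hw.2, hw.1⟩)).neg hη
    exact ⟨-H, b, f, fun a ha => by linarith [h1 a ha], fun b hb => by linarith [h2 b hb]⟩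
  choose H b f hge hle using key
  have h1mem := one_mem_freezingSignals t T
  let m : controlSignals B t T × freezingSignals t T → ShiftScheme V A B t T := fun w =>
    { original := fun S => traj F t T y₀ (γ S.2.1) S.2.1 (fun _ => 1)
      frozen := fun S => traj F t T y₀ S.2.2 w.1 w.2
      value := H
      signalA := fun x p => responseSignal hF.compact_A (f x p) w.1
      signalB := fun x p => constSignal hF.compact_B t T (b x p) }
  obtain ⟨a₀, ha₀⟩ := hA
  obtain ⟨b₀, hb₀⟩ := hB
  let S₀ : ShiftState A B t T :=
    (t, constSignal hF.compact_B t T ⟨b₀, hb₀⟩, constSignal hF.compact_A t T ⟨a₀, ha₀⟩)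
  let S : controlSignals B t T × freezingSignals t T → ShiftState A B t T := fun w =>
    (m w).run hF.compact_A hF.compact_B h S₀ N
  refine ⟨fun w => (S w).2.2, fun r hr β₁ β₂ μ₁ μ₂ hβ hμ => ?_,
    fun β μ => ⟨(S (β, μ)).2.1, ?_⟩⟩
  · refine (ShiftScheme.run_agree_A (m := m (β₁, μ₁)) (m' := m (β₂, μ₂)) hF.compact_A hF.compact_B
      (S₀ := S₀) hh hN (fun S S' hS => ?_) (fun S S' s hs hsr hagree => ?_) rfl rfl
      (fun x p => hβ.response hF.compact_A (f x p)) le_rfl).1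
    · simp only [m, hS]
    · exact hF.traj_congr S.2.2.2 β₁.2 μ₁.2 S'.2.2.2 β₂.2 μ₂.2 hs hagree (hβ.mono hsr)
        (hμ.mono hsr) ⟨hs.1, le_rfl⟩
  · have hm : (m (β, μ)).IsCausal :=
      ⟨fun S S' s hs hagree => hF.traj_congr (γ S.2.1).2 S.2.1.2 h1mem (γ S'.2.1).2 S'.2.1.2
        h1mem hs (hγ s hs _ _ hagree) hagree (AgreeUpTo.refl _ _ _) ⟨hs.1, le_rfl⟩,
      fun S S' s hs hagree => hF.traj_congr S.2.2.2 β.2 μ.2 S'.2.2.2 β.2 μ.2 hs hagree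
        (AgreeUpTo.refl _ _ _) (AgreeUpTo.refl _ _ _) ⟨hs.1, le_rfl⟩⟩
    exact hcost _ (γ (S (β, μ)).2.1).2 _ (S (β, μ)).2.1.2 _ (S (β, μ)).2.2.2 _ β.2 _ μ.2 _
      ((m (β, μ)).isExtremalShift hF.compact_A hF.compact_B S₀ hm hh rfl hN
        (fun x p s hs => hle x p _ (β.2.1 s hs))
        (fun x p s hs => hge x p _ ((γ (S (β, μ)).2.1).2.1 s hs)))

theorem le_of_forall_pos_le_add_coe {a b : EReal}
    (h : ∀ ε : ℝ, 0 < ε → a ≤ b + (ε : EReal)) : a ≤ b := by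
  induction b with
  | bot => simpa using h 1 one_pos
  | top => exact le_top
  | coe b =>
    refine EReal.le_of_forall_lt_iff_le.1 fun z hz => ?_
    have := h (z - b) (sub_pos.2 (EReal.coe_lt_coe_iff.1 hz))
    rwa [← EReal.coe_add, add_sub_cancel] at this

theorem controlSignals_nonempty_iff (hA : IsCompact A) (htT : t ≤ T) :
    Nonempty (controlSignals A t T) ↔ A.Nonempty :=
  ⟨fun ⟨u⟩ => ⟨u.1 t, u.2.1 t ⟨le_rfl, htT⟩⟩, fun ⟨a, ha⟩ => ⟨constSignal hA t T ⟨a, ha⟩⟩⟩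

theorem IsGameField.iSup_fixedCost_le (hF : IsGameField A B F K) (htT : t ≤ T)
    (hsymm : ∀ v w, G v w = G w v) (hpos : ∀ v, ‖v‖ ^ 2 ≤ G v v) (hC : 0 < C)
    (hφ : ∀ v w, φ v ≤ φ w + C * ‖v - w‖) (hψ : ∀ v w, ψ v ≤ ψ w + C * ‖v - w‖) :
    (⨆ δ ∈ strategies A B t T, ⨆ ν ∈ strategies A (Icc (0 : ℝ) 1) t T,
        ⨅ α : controlSignals A t T, fixedCost F φ ψ T t y₀ α (δ α) (ν α)) ≤
      ⨆ δ ∈ strategies A B t T, ⨅ α : controlSignals A t T, freeCost F φ ψ T t y₀ α (δ α) := by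
  refine iSup₂_le fun δ hδ => iSup₂_le fun ν hν => ?_
  rcases isEmpty_or_nonempty (controlSignals A t T) with hempty | hne
  -- Without signals of A the infimum is over an empty family, hence `⊤`.
  · exact le_iSup₂_of_le δ hδ (le_iInf fun α => hempty.elim α)
  obtain ⟨α₀⟩ := hne
  have hA := (controlSignals_nonempty_iff hF.compact_A htT).1 ⟨α₀⟩
  have hB := (controlSignals_nonempty_iff hF.compact_B htT).1 ⟨δ α₀⟩
  refine le_of_forall_pos_le_add_coe fun ε hε => ?_
  obtain ⟨δ', hδ', h⟩ := hF.exists_strategy_original (y₀ := y₀) htT hsymm hpos hC hφ hψ hA hB hδ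
    hν hε
  rw [← EReal.sub_le_iff_le_add (Or.inl (EReal.coe_ne_bot ε)) (Or.inl (EReal.coe_ne_top ε))]
  refine le_iSup₂_of_le δ' hδ' (le_iInf fun α => ?_)
  rw [EReal.sub_le_iff_le_add (Or.inl (EReal.coe_ne_bot ε)) (Or.inl (EReal.coe_ne_top ε))]
  obtain ⟨α', hα'⟩ := h α
  exact (iInf_le _ α').trans hα'

theorem IsGameField.iInf_fixedCost_le (hF : IsGameField A B F K) (htT : t ≤ T)
    (hsymm : ∀ v w, G v w = G w v) (hpos : ∀ v, ‖v‖ ^ 2 ≤ G v v) (hC : 0 < C)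
    (hφ : ∀ v w, φ v ≤ φ w + C * ‖v - w‖) (hψ : ∀ v w, ψ v ≤ ψ w + C * ‖v - w‖) :
    (⨅ γ ∈ strategies₂ B (Icc (0 : ℝ) 1) A t T,
        ⨆ (β : controlSignals B t T) (μ : freezingSignals t T),
          fixedCost F φ ψ T t y₀ (γ (β, μ)) β μ) ≤
      ⨅ γ ∈ strategies B A t T, ⨆ β : controlSignals B t T, freeCost F φ ψ T t y₀ (γ β) β := by
  refine le_iInf₂ fun γ hγ => ?_
  rcases isEmpty_or_nonempty (controlSignals B t T) with hempty | hne
  -- Without signals of B the empty map is a strategy and the supremum is `⊥`.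
  · exact iInf₂_le_of_le (fun w => hempty.elim w.1) (fun s _ u => hempty.elim u)
      (iSup_le fun β => hempty.elim β)
  obtain ⟨β₀⟩ := hne
  have hB := (controlSignals_nonempty_iff hF.compact_B htT).1 ⟨β₀⟩
  have hA := (controlSignals_nonempty_iff hF.compact_A htT).1 ⟨γ β₀⟩
  refine le_of_forall_pos_le_add_coe fun ε hε => ?_
  obtain ⟨γ', hγ', h⟩ := hF.exists_strategy_frozen (y₀ := y₀) htT hsymm hpos hC hφ hψ hA hB hγ hε
  refine iInf₂_le_of_le γ' hγ' (iSup₂_le fun β μ => ?_)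
  obtain ⟨β', hβ'⟩ := h β μ
  refine hβ'.trans ?_
  gcongr
  exact le_iSup (fun β : controlSignals B t T => freeCost F φ ψ T t y₀ (γ β) β) β'

end Values

/-! ### Reduction to the augmented state. -/

section AugmentedState

variable {n p q : ℕ}
  {A : Set (EuclideanSpace ℝ (Fin p))} {B : Set (EuclideanSpace ℝ (Fin q))}
  {f : EuclideanSpace ℝ (Fin n) → EuclideanSpace ℝ (Fin p) →
    EuclideanSpace ℝ (Fin q) → EuclideanSpace ℝ (Fin n)}
  {L : EuclideanSpace ℝ (Fin n) → EuclideanSpace ℝ (Fin p) → EuclideanSpace ℝ (Fin q) → ℝ}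
  {g c : EuclideanSpace ℝ (Fin n) → ℝ}

/-- The velocity of the augmented state. -/
def augmentedField (f : EuclideanSpace ℝ (Fin n) → EuclideanSpace ℝ (Fin p) →
      EuclideanSpace ℝ (Fin q) → EuclideanSpace ℝ (Fin n))
    (L : EuclideanSpace ℝ (Fin n) → EuclideanSpace ℝ (Fin p) → EuclideanSpace ℝ (Fin q) → ℝ)
    (y : EuclideanSpace ℝ (Fin n) × ℝ) (a : EuclideanSpace ℝ (Fin p))
    (b : EuclideanSpace ℝ (Fin q)) : EuclideanSpace ℝ (Fin n) × ℝ :=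
  (f y.1 a b, -L y.1 a b)

theorem StandingAssumptions.exists_isGameField (hyp : StandingAssumptions A B f L g c) :
    ∃ K, IsGameField A B (augmentedField f L) K ∧ IsGameField A B f K := by
  obtain ⟨K₁, h₁⟩ := hyp.lipschitz_f
  obtain ⟨K₂, h₂⟩ := hyp.lipschitz_L
  have hf : ∀ a ∈ A, ∀ b ∈ B, ∀ x x', ‖f x a b - f x' a b‖ ≤ max (K₁ : ℝ) K₂ * ‖x - x'‖ := by
    intro a ha b hb x x'
    refine ((h₁ a ha b hb).norm_sub_le x x').trans ?_
    gcongr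
    exact le_max_left _ _
  refine ⟨max K₁ K₂, ⟨hyp.compact_A, hyp.compact_B, by positivity, fun a ha b hb y y' => ?_,
    fun y => (hyp.continuous_f y.1).prodMk (hyp.continuous_L y.1).neg⟩,
    ⟨hyp.compact_A, hyp.compact_B, by positivity, hf, hyp.continuous_f⟩⟩
  have hy : ‖y.1 - y'.1‖ ≤ ‖y - y'‖ := norm_fst_le (y - y')
  refine norm_prod_le_iff.2 ⟨(hf a ha b hb _ _).trans (by gcongr), ?_⟩
  have := (h₂ a ha b hb).norm_sub_le y.1 y'.1
  simp only [augmentedField, Prod.snd_sub]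
  rw [← neg_sub', norm_neg]
  refine this.trans ?_
  gcongr
  exact le_max_right _ _

/-- The second component decreases at rate `L`, so subtracting it from `g` adds the running cost and
removes the initial `z`. The first component solves the equation of `f`, so by uniqueness it is the
trajectory that `solution` selects. -/
theorem StandingAssumptions.J₁_eq_freeCost (hyp : StandingAssumptions A B f L g c) {T t : ℝ}
    (htT : t ≤ T) (x : EuclideanSpace ℝ (Fin n)) (z : ℝ) (α : controlSignals A t T)
    (β : controlSignals B t T) :
    J₁ (fun _ => f) (fun _ => L) (fun _ => g) (fun _ => c) T t x z α β =
      freeCost (augmentedField f L) (fun y => c y.1) (fun y => g y.1 - y.2) T t (x, z) α β := by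
  obtain ⟨K, hF, hf⟩ := hyp.exists_isGameField
  have h1 := one_mem_freezingSignals t T
  have hY := hF.isSolution_traj (y₀ := (x, z)) htT α.2 β.2 h1
  set Y := traj (augmentedField f L) t T (x, z) α β (fun _ => 1) with hYdef
  simp only [one_smul] at hY
  have hint : ∀ s ∈ Icc t T, IntervalIntegrable
      (fun s => augmentedField f L (Y s) ((α : ℝ → _) s) ((β : ℝ → _) s)) volume t s :=
    fun s hs => (hY.of_restrict hs).2.1
  have hX : EqOn (fun s => (Y s).1)
      (traj f t T x α β (fun _ => 1)) (Icc t T) := by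
    refine hf.traj_eq htT α.2 β.2 h1 ?_
    simp only [one_smul]
    refine ⟨continuous_fst.comp_continuousOn hY.1, ?_, fun s hs => ?_⟩
    · exact ⟨hY.2.1.1.fst, hY.2.1.2.fst⟩
    · have := congrArg (ContinuousLinearMap.fst ℝ (EuclideanSpace ℝ (Fin n)) ℝ) (hY.2.2 s hs)
      rw [map_add, ← ContinuousLinearMap.intervalIntegral_comp_comm _ (hint s hs)] at this
      exact this
  have hL : ∀ s ∈ Icc t T, (Y s).2 = z - ∫ r in t..s, L (Y r).1 ((α : ℝ → _) r) ((β : ℝ → _) r) := by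
    intro s hs
    have := congrArg (ContinuousLinearMap.snd ℝ (EuclideanSpace ℝ (Fin n)) ℝ) (hY.2.2 s hs)
    rw [map_add, ← ContinuousLinearMap.intervalIntegral_comp_comm _ (hint s hs)] at this
    simp only [augmentedField, ContinuousLinearMap.coe_snd', intervalIntegral.integral_neg] at this
    rw [this, sub_eq_add_neg]
  have hsol : solution (fun s y => f y ((α : ℝ → _) s) ((β : ℝ → _) s)) t T x =
      traj f t T x α β (fun _ => 1) := by
    simp only [traj, one_smul]
  unfold J₁ freeCost
  simp only [hsol]
  refine iSup_congr fun τ => iSup_congr fun hτ => ?_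
  have hle : ∀ s ∈ Icc t τ, s ∈ Icc t T := fun s hs => ⟨hs.1, hs.2.trans hτ.2⟩
  congr 1
  · refine iSup_congr fun s => iSup_congr fun hs => ?_
    rw [← hX (hle s hs)]
  · have hint' : ∫ s in t..τ, L (traj f t T x α β (fun _ => 1) s) ((α : ℝ → _) s) ((β : ℝ → _) s) =
        ∫ s in t..τ, L (Y s).1 ((α : ℝ → _) s) ((β : ℝ → _) s) := by
      refine intervalIntegral.integral_congr fun s hs => ?_
      rw [uIcc_of_le hτ.1] at hs
      rw [← hX (hle s hs)]
    rw [hint', ← hX hτ, hL τ hτ]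
    congr 1
    ring

theorem Jtilde_eq_fixedCost (T t : ℝ) (x : EuclideanSpace ℝ (Fin n)) (z : ℝ)
    (α : ℝ → EuclideanSpace ℝ (Fin p)) (β : ℝ → EuclideanSpace ℝ (Fin q)) (μ : ℝ → ℝ) :
    Jtilde f L g c T t x z α β μ =
      fixedCost (augmentedField f L) (fun y => c y.1) (fun y => g y.1 - y.2) T t (x, z) α β μ :=
  rfl

/-- The Euclidean inner product of the augmented state space. -/
def augmentedInner (n : ℕ) : (EuclideanSpace ℝ (Fin n) × ℝ) →L[ℝ]
    (EuclideanSpace ℝ (Fin n) × ℝ) →L[ℝ] ℝ :=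
  (innerSL ℝ).bilinearComp (ContinuousLinearMap.fst ℝ (EuclideanSpace ℝ (Fin n)) ℝ)
      (ContinuousLinearMap.fst ℝ (EuclideanSpace ℝ (Fin n)) ℝ) +
    (innerSL ℝ).bilinearComp (ContinuousLinearMap.snd ℝ (EuclideanSpace ℝ (Fin n)) ℝ)
      (ContinuousLinearMap.snd ℝ (EuclideanSpace ℝ (Fin n)) ℝ)

theorem augmentedInner_apply (v w : EuclideanSpace ℝ (Fin n) × ℝ) :
    augmentedInner n v w = inner ℝ v.1 w.1 + inner ℝ v.2 w.2 := rfl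

theorem augmentedInner_symm (v w : EuclideanSpace ℝ (Fin n) × ℝ) :
    augmentedInner n v w = augmentedInner n w v := by
  simp only [augmentedInner_apply, real_inner_comm]

/-- The product carries the maximum norm, so the quadratic estimate of the extremal shift is run
with the Euclidean form and returns to the norm through this bound. -/
theorem sq_norm_le_augmentedInner (v : EuclideanSpace ℝ (Fin n) × ℝ) :
    ‖v‖ ^ 2 ≤ augmentedInner n v v := by
  rw [augmentedInner_apply, real_inner_self_eq_norm_sq, real_inner_self_eq_norm_sq, Prod.norm_def]
  rcases max_choice ‖v.1‖ ‖v.2‖ with h | h <;> rw [h] <;>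
    nlinarith [sq_nonneg ‖v.1‖, sq_nonneg ‖v.2‖]

theorem StandingAssumptions.exists_lipschitz_costs (hyp : StandingAssumptions A B f L g c) :
    ∃ C : ℝ, 0 < C ∧ Continuous g ∧ Continuous c ∧
      (∀ v w : EuclideanSpace ℝ (Fin n) × ℝ, c v.1 ≤ c w.1 + C * ‖v - w‖) ∧
      ∀ v w : EuclideanSpace ℝ (Fin n) × ℝ, g v.1 - v.2 ≤ g w.1 - w.2 + C * ‖v - w‖ := by
  obtain ⟨K₁, h₁⟩ := hyp.lipschitz_g
  obtain ⟨K₂, h₂⟩ := hyp.lipschitz_c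
  have hK₁ := K₁.2
  have hK₂ := K₂.2
  refine ⟨K₁ + K₂ + 1, by positivity, h₁.continuous, h₂.continuous, fun v w => ?_, fun v w => ?_⟩
  · have h3 := (le_abs_self _).trans (h₂.norm_sub_le v.1 w.1)
    have h4 : ‖v.1 - w.1‖ ≤ ‖v - w‖ := norm_fst_le (v - w)
    have h5 : (K₂ : ℝ) * ‖v.1 - w.1‖ ≤ (K₁ + K₂ + 1) * ‖v - w‖ := by
      gcongr
      linarith [K₁.coe_nonneg]
    linarith
  · have h3 := (le_abs_self _).trans (h₁.norm_sub_le v.1 w.1)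
    have h4 : ‖v.1 - w.1‖ ≤ ‖v - w‖ := norm_fst_le (v - w)
    have h6 : ‖v.2 - w.2‖ ≤ ‖v - w‖ := norm_snd_le (v - w)
    have h7 := (neg_le_abs _).trans h6
    have h5 : (K₁ : ℝ) * ‖v.1 - w.1‖ ≤ K₁ * ‖v - w‖ := by gcongr
    have h8 : 0 ≤ (K₂ : ℝ) * ‖v - w‖ := by positivity
    linarith

end AugmentedState

end ZeroSumGame

end

theorem lemma3 {n p q : ℕ}
    (A : Set (EuclideanSpace ℝ (Fin p))) (B : Set (EuclideanSpace ℝ (Fin q)))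
    (f : EuclideanSpace ℝ (Fin n) → EuclideanSpace ℝ (Fin p) →
      EuclideanSpace ℝ (Fin q) → EuclideanSpace ℝ (Fin n))
    (L : EuclideanSpace ℝ (Fin n) → EuclideanSpace ℝ (Fin p) → EuclideanSpace ℝ (Fin q) → ℝ)
    (g c : EuclideanSpace ℝ (Fin n) → ℝ)
    (hyp : ZeroSumGame.StandingAssumptions A B f L g c)
    (T t : ℝ) (ht : t ∈ Set.Icc 0 T) (x : EuclideanSpace ℝ (Fin n)) (z : ℝ) :
    ZeroSumGame.V₁upper A B (fun _ => f) (fun _ => L) (fun _ => g) (fun _ => c) T t x z =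
        (⨆ δ ∈ ZeroSumGame.strategies A B t T,
          ⨆ ν ∈ ZeroSumGame.strategies A (Set.Icc (0 : ℝ) 1) t T,
            ⨅ α : ZeroSumGame.controlSignals A t T,
              ZeroSumGame.Jtilde f L g c T t x z α (δ α) (ν α)) ∧
      ZeroSumGame.V₁lower A B (fun _ => f) (fun _ => L) (fun _ => g) (fun _ => c) T t x z =
        (⨅ γ ∈ ZeroSumGame.strategies₂ B (Set.Icc (0 : ℝ) 1) A t T,
          ⨆ (β : ZeroSumGame.controlSignals B t T) (μ : ZeroSumGame.freezingSignals t T),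
            ZeroSumGame.Jtilde f L g c T t x z (γ (β, μ)) β μ) := by
  obtain ⟨K, hF, -⟩ := hyp.exists_isGameField
  obtain ⟨C, hC, hg, hc, hφ, hψ⟩ := hyp.exists_lipschitz_costs
  have hc' : Continuous fun y : EuclideanSpace ℝ (Fin n) × ℝ => c y.1 := by fun_prop
  have hg' : Continuous fun y : EuclideanSpace ℝ (Fin n) × ℝ => g y.1 - y.2 := by fun_prop
  unfold ZeroSumGame.V₁upper ZeroSumGame.V₁lower
  simp only [hyp.J₁_eq_freeCost ht.2, ZeroSumGame.Jtilde_eq_fixedCost]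
  exact ⟨le_antisymm (hF.iSup_freeCost_le hc' hg' ht.2)
      (hF.iSup_fixedCost_le ht.2 ZeroSumGame.augmentedInner_symm
        ZeroSumGame.sq_norm_le_augmentedInner hC hφ hψ),
    le_antisymm hF.iInf_freeCost_le
      (hF.iInf_fixedCost_le ht.2 ZeroSumGame.augmentedInner_symm
        ZeroSumGame.sq_norm_le_augmentedInner hC hφ hψ)⟩
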